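/- Let $\boldsymbol{k}$ be a field of characteristic zero and let $(L,A)$ be a Lie–Rinehart algebra over $\boldsymbol{k}$: $A$ is a commutative $\boldsymbol{k}$-algebra, $L$ is a $\boldsymbol{k}$-Lie algebra and an $A$-module which acts on $A$ by derivations, $A$-linearly in $L$, with $[X,aY]=X(a)Y+a[X,Y]$. Let $\mathrm{H}_{\mathrm{dR}}(L,A)$ be the naive de Rham cohomology, i.e. the cohomology of the complex $\operatorname{Alt}_A(L,A)=\bigoplus_m\operatorname{Alt}^m_A(L,A)$ of alternating $A$-multilinear forms with the Koszul differential $$(d_{\mathrm{dR}}\omega)(X_0,\dots,X_m)=\sum_{l}(-1)^lX_l\big(\omega(\dots,\widehat{X_l},\dots)\big)+\sum_{j<l}(-1)^{j+l}\omega([X_j,X_l],\dots,\widehat{X_j},\dots,\widehat{X_l},\dots),$$ and let $\cup$ be the cup product on $\mathrm{H}_{\mathrm{dR}}(L,A)$ induced by the shuffle product of forms $$(\omega\cup\omega')(X_1,\dots,X_{p+q})=\sum_{\sigma\in\mathrm{Sh}_{p,q}}(-1)^{|\sigma|}\omega(X_{\sigma(1)},\dots,X_{\sigma(p)})\,\omega'(X_{\sigma(p+1)},\dots,X_{\sigma(p+q)}).$$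 An $L$-connection on an $A$-module $V$ is an $A$-linear assignment $X\mapsto\nabla_X$ of $\boldsymbol{k}$-linear endomorphisms of $V$ with $\nabla_X(av)=X(a)v+a\nabla_Xv$; its curvature is the $\operatorname{End}_A(V)$-valued $2$-form $\mathcal{R}(X,Y)=[\nabla_X,\nabla_Y]-\nabla_{[X,Y]}$. Assume that $L$ is a finitely generated $A$-module, and let $\kappa\in\boldsymbol{k}^\times$. Every finitely generated projective $A$-module $V$ admits an $L$-connection, and its Chern character is the class $$\operatorname{ch}_\kappa(V):=\big[\operatorname{trace}_V(\exp(\kappa\mathcal{R}))\big]\in \mathrm{H}_{\mathrm{dR}}(L,A),$$ where $\mathcal{R}$ is the curvature of some $L$-connection on $V$, $\exp(\kappa\mathcal{R})=\sum_m\frac{\kappa^m}{m!}\mathcal{R}^{\cup m}$ (a finite sum, since $L$ is finitely generated; $\cup$ of $\operatorname{End}_A(V)$-valued forms uses composition of endomorphisms) and $\operatorname{trace}_V:\operatorname{End}_A(V)\to A$ is the trace of the finitely generated projective module $V$, applied to the values of forms. Then, for all finitely generated projective $A$-modules $V$ and $V'$, the classes $\operatorname{ch}_\kappa(V)$ and $\operatorname{ch}_\kappa(V')$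 do not depend on the choice of the $L$-connection, and $$\operatorname{ch}_\kappa(V\oplus V')=\operatorname{ch}_\kappa(V)+\operatorname{ch}_\kappa(V'),\qquad \operatorname{ch}_\kappa(V\otimes_AV')=\operatorname{ch}_\kappa(V)\cup\operatorname{ch}_\kappa(V')\quad\text{in } \mathrm{H}_{\mathrm{dR}}(L,A).$$ -/

import Mathlib

open scoped TensorProduct
set_option linter.unusedSectionVars false

namespace LieRinehart

section Basic

variable (k A L V : Type*) [Field k] [CommRing A] [Algebra k A]
  [LieRing L] [LieAlgebra k L] [Module A L] [LieRingModule L A] [LieRinehartRing A L]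
  [LieRinehartAlgebra k A L]
  [AddCommGroup V] [Module k V] [Module A V] [IsScalarTower k A V]

/-- An `L`-connection on the `A`-module `V`: an `A`-linear assignment `X ↦ ∇_X` of `k`-linear
endomorphisms of `V` with `∇_X (a v) = X(a) v + a ∇_X v`. -/
structure Connection where
  toLin : L →ₗ[A] (V →ₗ[k] V)
  leibniz : ∀ (X : L) (a : A) (v : V), toLin X (a • v) = ⁅X, a⁆ • v + a • toLin X v

/-- The canonical connection `X ↦ (a ↦ X(a))` on `A`. -/
def trivialConnection : Connection k A L A where
  toLin :=
    { toFun := fun X => LieModule.toEnd k L A X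
      map_add' := fun X Y => by ext a; simp
      map_smul' := fun b X => by ext a; simp }
  leibniz := fun X a b => by simp [mul_comm, add_comm]

end Basic

section

variable {k A L V : Type*} [Field k] [CommRing A] [Algebra k A]
  [LieRing L] [LieAlgebra k L] [Module A L] [LieRingModule L A] [LieRinehartRing A L]
  [LieRinehartAlgebra k A L]
  [AddCommGroup V] [Module k V] [Module A V] [IsScalarTower k A V]

/-- The map `R(X, Y) = [∇_X, ∇_Y] - ∇_[X, Y]`, as an `A`-linear endomorphism of `V`. -/
def curvatureEnd (D : Connection k A L V) (X Y : L) : Module.End A V where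
  toFun v := D.toLin X (D.toLin Y v) - D.toLin Y (D.toLin X v) - D.toLin ⁅X, Y⁆ v
  map_add' v w := by simp only [map_add]; abel
  map_smul' a v := by
    simp only [D.leibniz, map_add, RingHom.id_apply, smul_sub, lie_lie, sub_smul]
    abel

lemma curvatureEnd_smul_left (D : Connection k A L V) (a : A) (X Y : L) :
    curvatureEnd D (a • X) Y = a • curvatureEnd D X Y := by
  have h : ⁅a • X, Y⁆ = a • ⁅X, Y⁆ - ⁅Y, a⁆ • X := by
    rw [← lie_skew, LieRinehartRing.leibniz_smul_right, ← lie_skew X Y]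
    simp only [smul_neg, neg_add, sub_eq_add_neg]
  ext v
  simp only [curvatureEnd, LinearMap.coe_mk, AddHom.coe_mk, LinearMap.smul_apply, h, map_smul,
    map_sub, LinearMap.sub_apply, D.leibniz, smul_sub]
  abel

lemma curvatureEnd_neg (D : Connection k A L V) (X Y : L) :
    curvatureEnd D X Y = - curvatureEnd D Y X := by
  ext v
  simp only [curvatureEnd, LinearMap.coe_mk, AddHom.coe_mk, LinearMap.neg_apply]
  rw [← lie_skew X Y]
  simp only [map_neg, LinearMap.neg_apply]
  abel

lemma curvatureEnd_add_left (D : Connection k A L V) (X X' Y : L) :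
    curvatureEnd D (X + X') Y = curvatureEnd D X Y + curvatureEnd D X' Y := by
  ext v
  simp [curvatureEnd]
  abel

/-- The curvature endomorphism of a connection, an `End_A(V)`-valued 2-form. -/
def curvature (D : Connection k A L V) : L [⋀^Fin 2]→ₗ[A] Module.End A V where
  toFun v := curvatureEnd D (v 0) (v 1)
  map_update_add' v i x y := by
    fin_cases i
    · simp [curvatureEnd_add_left]
    · simp only [Fin.mk_one, Function.update_self, ne_eq, zero_ne_one, not_false_eq_true,
        Function.update_of_ne, Fin.isValue]
      rw [curvatureEnd_neg, curvatureEnd_add_left, curvatureEnd_neg D (v 0) x,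
        curvatureEnd_neg D (v 0) y, neg_add]
  map_update_smul' v i a x := by
    fin_cases i
    · simp [curvatureEnd_smul_left]
    · simp only [Fin.mk_one, Function.update_self, ne_eq, zero_ne_one, not_false_eq_true,
        Function.update_of_ne, Fin.isValue]
      rw [curvatureEnd_neg, curvatureEnd_smul_left, curvatureEnd_neg D (v 0) x, smul_neg]
  map_eq_zero_of_eq' := by
    intro v i j h hij
    have : v 0 = v 1 := by
      fin_cases i <;> fin_cases j <;> simp_all
    ext w
    simp [curvatureEnd, this]

/-- The connection induced on `End_A(V)`: `(∇_X φ)(v) = ∇_X (φ v) - φ (∇_X v)`. -/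
def Connection.onEnd (D : Connection k A L V) : Connection k A L (Module.End A V) where
  toLin :=
    { toFun := fun X =>
        { toFun := fun φ =>
            { toFun := fun v => D.toLin X (φ v) - φ (D.toLin X v)
              map_add' := fun v w => by simp only [map_add]; abel
              map_smul' := fun a v => by
                simp only [map_smul, D.leibniz, map_add, RingHom.id_apply, smul_sub]; abel }
          map_add' := fun φ ψ => by ext v; simp; abel
          map_smul' := fun c φ => by ext v; simp [smul_sub] }
      map_add' := fun X Y => by ext φ v; simp; abel
      map_smul' := fun a X => by ext φ v; simp [smul_sub] }
  leibniz := fun X a φ => by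
    ext v
    simp [D.leibniz, smul_sub]; abel

/-- Connections exist on projective modules. -/
theorem Connection.nonempty_of_projective [Module.Projective A V] :
    Nonempty (Connection k A L V) := by
  obtain ⟨s, hs⟩ := Module.projective_def'.mp (inferInstance : Module.Projective A V)
  have hs' : ∀ v, Finsupp.linearCombination A id (s v) = v := fun v => LinearMap.congr_fun hs v
  let δ : L → (V →₀ A) →ₗ[k] (V →₀ A) := fun X =>
    Finsupp.mapRange.linearMap (LieModule.toEnd k L A X)
  have hδ : ∀ X f w, δ X f w = ⁅X, f w⁆ := fun X f w => by simp [δ]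
  refine ⟨⟨{ toFun := fun X => ((Finsupp.linearCombination A id).restrictScalars k) ∘ₗ (δ X) ∘ₗ
      (s.restrictScalars k), map_add' := ?_, map_smul' := ?_ }, ?_⟩⟩
  · intro X Y
    have : ∀ f, δ (X + Y) f = δ X f + δ Y f := fun f => by ext w; simp [hδ]
    ext v; simp [this]
  · intro a X
    have : ∀ f, δ (a • X) f = a • δ X f := fun f => by ext w; simp [hδ]
    ext v; simp [this]
  · intro X a v
    have : ∀ f, δ X (a • f) = ⁅X, a⁆ • f + a • δ X f := fun f => by
      ext w; simp [hδ]; ring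
    simp [this, hs']

end

section Trace

variable (A V : Type*) [CommRing A] [AddCommGroup V] [Module A V] [Module.Finite A V]
  [Module.Projective A V]

/-- The trace `End_A(V) → A` of a finitely generated projective module: the contraction
`V* ⊗ V → A`, transported along the isomorphism `V* ⊗ V ≃ End_A(V)`. -/
noncomputable def projTrace : Module.End A V →ₗ[A] A :=
  contractLeft A V ∘ₗ (dualTensorHomEquiv A V V).symm.toLinearMap

variable {A V}

theorem projTrace_dualTensorHom (f : Module.Dual A V) (v : V) :
    projTrace A V (dualTensorHom A V V (f ⊗ₜ v)) = f v := by
  have : dualTensorHom A V V (f ⊗ₜ v) = dualTensorHomEquiv A V V (f ⊗ₜ v) := rfl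
  rw [this, projTrace, LinearMap.comp_apply, LinearEquiv.coe_coe, LinearEquiv.symm_apply_apply,
    contractLeft_apply]

/-- For every coordinate system `(v_i, v^i)` of `V` the trace is `φ ↦ ∑ v^i(φ(v_i))`. -/
theorem projTrace_eq_sum {ι : Type*} [Fintype ι] (v : ι → V) (f : ι → Module.Dual A V)
    (h : ∀ w, ∑ i, f i w • v i = w) (φ : Module.End A V) :
    projTrace A V φ = ∑ i, f i (φ (v i)) := by
  have : φ = ∑ i, dualTensorHom A V V ((f i) ⊗ₜ φ (v i)) := by
    ext w
    conv_lhs => rw [← h w]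
    rw [map_sum, LinearMap.sum_apply]
    exact Finset.sum_congr rfl fun i _ => by rw [map_smul, dualTensorHom_apply]
  refine (congrArg (projTrace A V) this).trans ?_
  rw [map_sum]
  exact Finset.sum_congr rfl fun i _ => projTrace_dualTensorHom _ _

end Trace

section

variable {k A L V : Type*} [Field k] [CommRing A] [Algebra k A]
  [LieRing L] [LieAlgebra k L] [Module A L] [LieRingModule L A] [LieRinehartRing A L]
  [LieRinehartAlgebra k A L]
  [AddCommGroup V] [Module k V] [Module A V] [IsScalarTower k A V]

/-- The trace is covariantly constant. -/
theorem projTrace_onEnd [Module.Finite A V] [Module.Projective A V] (D : Connection k A L V)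
    (X : L) (φ : Module.End A V) :
    projTrace A V (D.onEnd.toLin X φ) = ⁅X, projTrace A V φ⁆ := by
  obtain ⟨t, rfl⟩ := (dualTensorHomEquiv A V V).surjective φ
  induction t using TensorProduct.induction_on with
  | zero => simp
  | add x y hx hy => simp only [map_add, hx, hy, lie_add]
  | tmul f v =>
    let g : Module.Dual A V :=
      { toFun := fun w => ⁅X, f w⁆ - f (D.toLin X w)
        map_add' := fun w w' => by simp only [map_add, lie_add]; ring
        map_smul' := fun a w => by simp [D.leibniz]; ring }
    have e : dualTensorHomEquiv A V V (f ⊗ₜ v) = dualTensorHom A V V (f ⊗ₜ v) := rfl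
    have h : D.onEnd.toLin X (dualTensorHom A V V (f ⊗ₜ v))
        = dualTensorHom A V V (f ⊗ₜ (D.toLin X v)) + dualTensorHom A V V (g ⊗ₜ v) := by
      ext w
      simp [Connection.onEnd, g, D.leibniz, sub_smul]
      abel
    rw [e, h, map_add, projTrace_dualTensorHom, projTrace_dualTensorHom, projTrace_dualTensorHom]
    simp [g]

end

section CovDeriv

variable {k A L W : Type*} [Field k] [CharZero k] [CommRing A] [Algebra k A]
  [LieRing L] [LieAlgebra k L] [Module A L] [LieRingModule L A] [LieRinehartRing A L]
  [LieRinehartAlgebra k A L]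
  [AddCommGroup W] [Module k W] [Module A W] [IsScalarTower k A W]

/-- The bracket part of the Koszul formula. With `p = i.castSucc` and `q = j.succ`, the pairs
`i ≤ j` run through all pairs of positions `p < q`, and the summand is
`(-1)^(p+q) ω([X_p, X_q], X_0, …, X̂_p, …, X̂_q, …)`. -/
def koszulBracket : {n : ℕ} → (L [⋀^Fin n]→ₗ[A] W) → (Fin (n + 1) → L) → W
  | 0, _, _ => 0
  | n + 1, ω, v => ∑ i : Fin (n + 1), ∑ j ∈ Finset.Ici i,
      (-1 : ℤ) ^ ((i.castSucc : ℕ) + (j.succ : ℕ)) •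
        ω (Matrix.vecCons ⁅v i.castSucc, v j.succ⁆ (j.removeNth (i.castSucc.removeNth v)))

/-- The Koszul formula `∑ (-1)^i ∇_{X_i} ω(…, X̂_i, …)
+ ∑_{p < q} (-1)^(p+q) ω([X_p, X_q], …, X̂_p, …, X̂_q, …)`. -/
def koszul (D : Connection k A L W) {n : ℕ} (ω : L [⋀^Fin n]→ₗ[A] W) (v : Fin (n + 1) → L) : W :=
  (∑ i : Fin (n + 1), (-1 : ℤ) ^ (i : ℕ) • D.toLin (v i) (ω (i.removeNth v))) + koszulBracket ω v

/-- `∇_X Φ - ½ ∑ Φ(…, [X, x_j], …)`, an auxiliary expression. -/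
noncomputable def lam (D : Connection k A L W) {n : ℕ} (X : L) (Φ : (Fin n → L) → W)
    (x : Fin n → L) : W :=
  D.toLin X (Φ x) - (2⁻¹ : k) • ∑ j, Φ (Function.update x j ⁅X, x j⁆)

/-- An `A`-multilinear form, regarded as a `k`-multilinear form. -/
def altRestrict (k : Type*) [Field k] [Algebra k A] [Module k W] [IsScalarTower k A W]
    [Module k L] [IsScalarTower k A L]
    {n : ℕ} (ω : L [⋀^Fin n]→ₗ[A] W) : L [⋀^Fin n]→ₗ[k] W :=
  { ω.toMultilinearMap.restrictScalars k with
    map_eq_zero_of_eq' := ω.map_eq_zero_of_eq' }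

lemma altRestrict_apply {n : ℕ} (ω : L [⋀^Fin n]→ₗ[A] W) (v : Fin n → L) :
    altRestrict k ω v = ω v := rfl

/-- The Lie bracket as a bilinear map. -/
def bracketLin (k L : Type*) [Field k] [LieRing L] [LieAlgebra k L] : L →ₗ[k] L →ₗ[k] L :=
  LinearMap.mk₂ k (fun X Y => ⁅X, Y⁆) add_lie smul_lie lie_add fun c X Y => lie_smul c X Y

/-- `X ↦ (x ↦ ∑ ω(…, [X, x_j], …))` -/
def brk : {n : ℕ} → (L [⋀^Fin n]→ₗ[k] W) → (L →ₗ[k] L [⋀^Fin n]→ₗ[k] W)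
  | 0, _ => 0
  | _ + 1, ω => AlternatingMap.alternatizeUncurryFinLM ∘ₗ
      ((bracketLin k L).compr₂ ω.curryLeft)

lemma brk_apply {n : ℕ} (ω : L [⋀^Fin n]→ₗ[k] W) (X : L) (x : Fin n → L) :
    brk ω X x = ∑ j, ω (Function.update x j ⁅X, x j⁆) := by
  cases n with
  | zero => simp [brk]
  | succ n =>
    simp only [brk, LinearMap.comp_apply, AlternatingMap.alternatizeUncurryFinLM_apply,
      AlternatingMap.alternatizeUncurryFin_apply]
    refine Finset.sum_congr rfl fun j _ => ?_
    rw [← Fin.insertNth_removeNth, AlternatingMap.map_insertNth]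
    rfl

/-- `lam` as a linear map to the `k`-multilinear alternating forms. -/
noncomputable def lamAlt (D : Connection k A L W) {n : ℕ} (ω : L [⋀^Fin n]→ₗ[A] W) :
    L →ₗ[k] L [⋀^Fin n]→ₗ[k] W where
  toFun X := (D.toLin X).compAlternatingMap (altRestrict k ω)
    - (2⁻¹ : k) • brk (altRestrict k ω) X
  map_add' X Y := by
    ext x; simp [smul_add]; abel
  map_smul' c X := by
    ext x
    have : D.toLin (c • X) = c • D.toLin X := by
      rw [← algebraMap_smul A c X, map_smul, algebraMap_smul]
    simp [this, smul_sub, smul_comm c]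

lemma lamAlt_apply (D : Connection k A L W) {n : ℕ} (ω : L [⋀^Fin n]→ₗ[A] W) (X : L)
    (x : Fin n → L) : lamAlt D ω X x = lam D X ω x := by
  simp [lamAlt, lam, brk_apply, altRestrict_apply]

/-- symmetric form of the Koszul formula -/
lemma koszul_eq (D : Connection k A L W) {n : ℕ} (ω : L [⋀^Fin n]→ₗ[A] W)
    (v : Fin (n + 1) → L) :
    koszul D ω v = AlternatingMap.alternatizeUncurryFin (lamAlt D ω) v := by
  have hl : lamAlt D ω = lamAlt D ω + (2⁻¹ : k) • brk (altRestrict k ω)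
      - (2⁻¹ : k) • brk (altRestrict k ω) := by abel
  have h2 : koszulBracket ω v = - ((2⁻¹ : k) •
      AlternatingMap.alternatizeUncurryFin (brk (altRestrict k ω)) v) := by
    cases n with
    | zero => simp [koszulBracket, brk, AlternatingMap.alternatizeUncurryFin_apply]
    | succ n =>
      simp only [koszulBracket, brk,
        AlternatingMap.alternatizeUncurryFin_alternatizeUncurryFinLM_comp_apply]
      rw [Finset.smul_sum, ← Finset.sum_neg_distrib]
      refine Finset.sum_congr rfl fun i _ => ?_
      rw [Finset.smul_sum, ← Finset.sum_neg_distrib]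
      refine Finset.sum_congr rfl fun j _ => ?_
      have e1 : ∀ (X Y : L) (w : Fin n → L),
          (bracketLin k L).compr₂ (altRestrict k ω).curryLeft X Y w
            = ω (Matrix.vecCons ⁅X, Y⁆ w) := fun X Y w => rfl
      have e2 : ∀ (X Y : L) (w : Fin n → L), ω (Matrix.vecCons ⁅Y, X⁆ w)
            = - ω (Matrix.vecCons ⁅X, Y⁆ w) := fun X Y w => by
        have := (ω.curryLeft).map_neg ⁅X, Y⁆
        rw [lie_skew] at this
        exact congrArg (fun f => f w) this
      rw [e1, e1, e2 (v i.castSucc) (v j.succ), sub_neg_eq_add, ← two_smul k,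
        smul_comm _ (2 : k), smul_smul, inv_mul_cancel₀ two_ne_zero, one_smul,
        Fin.val_castSucc, Fin.val_succ, ← add_assoc, pow_succ, mul_neg_one, neg_smul]
  rw [koszul, h2]
  simp only [AlternatingMap.alternatizeUncurryFin_apply]
  rw [Finset.smul_sum, ← sub_eq_add_neg, ← Finset.sum_sub_distrib]
  refine Finset.sum_congr rfl fun i _ => ?_
  simp only [lamAlt, LinearMap.coe_mk, AddHom.coe_mk, smul_sub, AlternatingMap.sub_apply,
    AlternatingMap.smul_apply]
  rw [smul_comm]
  rfl

lemma koszul_eq_sum (D : Connection k A L W) {n : ℕ} (ω : L [⋀^Fin n]→ₗ[A] W)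
    (v : Fin (n + 1) → L) :
    koszul D ω v = ∑ i : Fin (n + 1), (-1 : ℤ) ^ (i : ℕ) • lam D (v i) ω (i.removeNth v) := by
  rw [koszul_eq, AlternatingMap.alternatizeUncurryFin_apply]
  simp only [lamAlt_apply]

lemma lam_smul_cons (D : Connection k A L W) {n : ℕ} (ω : L [⋀^Fin (n + 1)]→ₗ[A] W) (X Y : L)
    (a : A) (w : Fin n → L) :
    lam D Y ω (Matrix.vecCons (a • X) w) = a • lam D Y ω (Matrix.vecCons X w)
      + (2⁻¹ : k) • ⁅Y, a⁆ • ω (Matrix.vecCons X w) := by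
  have u0 : ∀ Z, Function.update (Matrix.vecCons Z w) 0 = fun Z' => Matrix.vecCons Z' w := by
    intro Z; funext Z'; exact Fin.update_cons_zero _ _ _
  have us : ∀ Z (j : Fin n) Z', Function.update (Matrix.vecCons Z w) j.succ Z'
      = Matrix.vecCons Z (Function.update w j Z') := by
    intro Z j Z'; exact (Fin.cons_update _ _ _ _).symm
  simp only [lam, Fin.sum_univ_succ, u0, us, Matrix.cons_val_zero, Matrix.cons_val_succ,
    AlternatingMap.map_vecCons_smul, D.leibniz, LieRinehartRing.leibniz_smul_right,
    AlternatingMap.map_vecCons_add, ← Finset.smul_sum, smul_add, smul_sub]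
  rw [smul_comm (2⁻¹ : k) a, smul_comm (2⁻¹ : k) a]
  have : ∀ z : W, z = (2⁻¹ : k) • z + (2⁻¹ : k) • z := fun z => by
    rw [← add_smul, ← two_mul, mul_inv_cancel₀ two_ne_zero, one_smul]
  nth_rw 1 [this (⁅Y, a⁆ • ω (Matrix.vecCons X w))]
  abel

lemma lam_smul (D : Connection k A L W) {n : ℕ} (ω : L [⋀^Fin n]→ₗ[A] W) (X : L)
    (a : A) (w : Fin n → L) :
    lam D (a • X) ω w = a • lam D X ω w
      + (2⁻¹ : k) • ∑ j, ⁅w j, a⁆ • ω (Function.update w j X) := by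
  have h : ∀ Y, ⁅a • X, Y⁆ = a • ⁅X, Y⁆ - ⁅Y, a⁆ • X := by
    intro Y
    rw [← lie_skew, LieRinehartRing.leibniz_smul_right, ← lie_skew X Y]
    simp only [smul_neg, neg_add, sub_eq_add_neg]
  simp only [lam, h, map_smul, LinearMap.smul_apply, AlternatingMap.map_update_sub,
    AlternatingMap.map_update_smul, Finset.sum_sub_distrib,
    ← Finset.smul_sum, smul_sub]
  rw [smul_comm (2⁻¹ : k) a]
  abel

lemma koszul_cons_smul (D : Connection k A L W) {n : ℕ} (ω : L [⋀^Fin n]→ₗ[A] W)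
    (a : A) (X : L) (w : Fin n → L) :
    koszul D ω (Matrix.vecCons (a • X) w) = a • koszul D ω (Matrix.vecCons X w) := by
  cases n with
  | zero => simp [koszul_eq_sum, lam, Matrix.vecCons]
  | succ n =>
    have r0 : ∀ Z : L, (0 : Fin (n + 2)).removeNth (Matrix.vecCons Z w) = w := fun Z => by
      exact Fin.removeNth_zero _
    have rs : ∀ (Z : L) (j : Fin (n + 1)), (j.succ).removeNth (Matrix.vecCons Z w)
        = Matrix.vecCons Z (j.removeNth w) := fun Z j => by
      funext i
      refine Fin.cases ?_ (fun i => ?_) i <;> simp [Fin.removeNth, Matrix.vecCons]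
    have hk : ∀ Z : L, koszul D ω (Matrix.vecCons Z w) = lam D Z ω w +
        ∑ j : Fin (n + 1), (-1 : ℤ) ^ (j.succ : ℕ) •
          lam D (w j) ω (Matrix.vecCons Z (j.removeNth w)) := fun Z => by
      rw [koszul_eq_sum, Fin.sum_univ_succ]
      simp only [r0, rs, Matrix.cons_val_zero, Matrix.cons_val_succ, Fin.val_zero, pow_zero,
        one_smul]
    simp only [hk, lam_smul_cons, lam_smul, smul_add, Finset.sum_add_distrib]
    have e : ∀ j : Fin (n + 1), ω (Function.update w j X)
        = (-1 : ℤ) ^ (j : ℕ) • ω (Matrix.vecCons X (j.removeNth w)) := fun j => by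
      rw [← Fin.insertNth_removeNth, AlternatingMap.map_insertNth]
    have e3 : (∑ x : Fin (n + 1), (-1 : ℤ) ^ (x.succ : ℕ) •
          (2⁻¹ : k) • ⁅w x, a⁆ • ω (Matrix.vecCons X (x.removeNth w)))
        = - ((2⁻¹ : k) • ∑ x, ⁅w x, a⁆ • ω (Function.update w x X)) := by
      rw [Finset.smul_sum, ← Finset.sum_neg_distrib]
      refine Finset.sum_congr rfl fun j _ => ?_
      rw [e, smul_comm (⁅w j, a⁆) ((-1 : ℤ) ^ (j : ℕ)), smul_comm (2⁻¹ : k) ((-1 : ℤ) ^ (j : ℕ)),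
        Fin.val_succ, pow_succ, mul_neg_one, neg_smul]
    rw [e3]
    have e4 : ∀ x : Fin (n + 1), a • (-1 : ℤ) ^ (x.succ : ℕ) •
        lam D (w x) ω (Matrix.vecCons X (x.removeNth w)) = (-1 : ℤ) ^ (x.succ : ℕ) • a •
        lam D (w x) ω (Matrix.vecCons X (x.removeNth w)) := fun x => smul_comm _ _ _
    simp only [Finset.smul_sum, e4]
    abel

/-- The covariant derivative of `W`-valued forms, given by the Koszul formula. -/
def covDeriv (D : Connection k A L W) {n : ℕ} (ω : L [⋀^Fin n]→ₗ[A] W) :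
    L [⋀^Fin (n + 1)]→ₗ[A] W where
  toFun v := koszul D ω v
  map_update_add' := @fun inst v i x y => by
    obtain rfl : inst = instDecidableEqFin _ := Subsingleton.elim _ _
    have := (AlternatingMap.alternatizeUncurryFin (lamAlt D ω)).map_update_add v i x y
    simp only [koszul_eq]
    exact this
  map_update_smul' := @fun inst v i a x => by
    obtain rfl : inst = instDecidableEqFin _ := Subsingleton.elim _ _
    have h : ∀ z, koszul D ω (Function.update v i z)
        = (-1 : ℤ) ^ (i : ℕ) • koszul D ω (Matrix.vecCons z (i.removeNth v)) := fun z => by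
      rw [← Fin.insertNth_removeNth, koszul_eq, koszul_eq, AlternatingMap.map_insertNth]
    rw [h, h, koszul_cons_smul, smul_comm]
  map_eq_zero_of_eq' v i j h hij := by
    rw [koszul_eq]
    exact AlternatingMap.map_eq_zero_of_eq _ v h hij

end CovDeriv
section Cup

variable {A L U W T : Type*} [CommRing A] [AddCommGroup L] [Module A L]
  [AddCommGroup U] [Module A U] [AddCommGroup W] [Module A W] [AddCommGroup T] [Module A T]

/-- The cup product along an `A`-bilinear map `μ`, i.e. the sum over all `(p, q)`-shuffles `σ` of
`sign σ • μ (ω (X_σ(1), …, X_σ(p))) (η (X_σ(p+1), …, X_σ(p+q)))`. -/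
def cupWith (μ : U →ₗ[A] W →ₗ[A] T) {p q : ℕ} (ω : L [⋀^Fin p]→ₗ[A] U) (η : L [⋀^Fin q]→ₗ[A] W) :
    L [⋀^Fin (p + q)]→ₗ[A] T :=
  ((TensorProduct.lift μ).compAlternatingMap (ω.domCoprod η)).domDomCongr finSumFinEquiv

lemma cupWith_add_left (μ : U →ₗ[A] W →ₗ[A] T) {p q : ℕ} (ω ω' : L [⋀^Fin p]→ₗ[A] U)
    (η : L [⋀^Fin q]→ₗ[A] W) : cupWith μ (ω + ω') η = cupWith μ ω η + cupWith μ ω' η := by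
  ext v
  simp only [cupWith, ← AlternatingMap.domCoprod'_apply, TensorProduct.add_tmul, map_add]
  simp

lemma cupWith_add_right (μ : U →ₗ[A] W →ₗ[A] T) {p q : ℕ} (ω : L [⋀^Fin p]→ₗ[A] U)
    (η η' : L [⋀^Fin q]→ₗ[A] W) : cupWith μ ω (η + η') = cupWith μ ω η + cupWith μ ω η' := by
  ext v
  simp only [cupWith, ← AlternatingMap.domCoprod'_apply, TensorProduct.tmul_add, map_add]
  simp

lemma cupWith_smul_left (μ : U →ₗ[A] W →ₗ[A] T) {p q : ℕ} (a : A) (ω : L [⋀^Fin p]→ₗ[A] U)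
    (η : L [⋀^Fin q]→ₗ[A] W) : cupWith μ (a • ω) η = a • cupWith μ ω η := by
  ext v
  simp only [cupWith, ← AlternatingMap.domCoprod'_apply, ← TensorProduct.smul_tmul', map_smul]
  simp

lemma cupWith_smul_right (μ : U →ₗ[A] W →ₗ[A] T) {p q : ℕ} (a : A) (ω : L [⋀^Fin p]→ₗ[A] U)
    (η : L [⋀^Fin q]→ₗ[A] W) : cupWith μ ω (a • η) = a • cupWith μ ω η := by
  ext v
  simp only [cupWith, ← AlternatingMap.domCoprod'_apply, TensorProduct.tmul_smul, map_smul]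
  simp

lemma factorial_smul_cupWith (μ : U →ₗ[A] W →ₗ[A] T) {p q : ℕ} (ω : L [⋀^Fin p]→ₗ[A] U)
    (η : L [⋀^Fin q]→ₗ[A] W) (v : Fin (p + q) → L) :
    (p.factorial * q.factorial) • cupWith μ ω η v = ∑ σ : Equiv.Perm (Fin (p + q)),
      Equiv.Perm.sign σ • μ (ω fun i => v (σ (Fin.castAdd q i)))
        (η fun j => v (σ (Fin.natAdd p j))) := by
  have h := congrArg (fun f => TensorProduct.lift μ (f (v ∘ finSumFinEquiv)))
    (MultilinearMap.domCoprod_alternization_eq ω η)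
  simp only [Fintype.card_fin] at h
  have h2 : (p.factorial * q.factorial) • cupWith μ ω η v = TensorProduct.lift μ
      (((p.factorial * q.factorial) • ω.domCoprod η) (v ∘ finSumFinEquiv)) := by
    simp only [AlternatingMap.smul_apply, map_nsmul]
    rfl
  rw [h2, ← h, MultilinearMap.alternatization_apply, map_sum]
  refine Fintype.sum_equiv (Equiv.permCongr finSumFinEquiv) _ _ fun σ => ?_
  rw [Equiv.Perm.sign_permCongr]
  rcases Int.units_eq_one_or (Equiv.Perm.sign σ) with h | h <;>
  simp [h, Function.comp_def, Equiv.permCongr_apply]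

lemma sum_removeNth {n : ℕ} (H : L → (Fin n → L) → W) (v : Fin (n + 1) → L) :
    ∑ l : Fin (n + 1), (-1 : ℤ) ^ (l : ℕ) • ∑ τ : Equiv.Perm (Fin n),
      Equiv.Perm.sign τ • H (v l) (fun j => l.removeNth v (τ j))
    = ∑ σ : Equiv.Perm (Fin (n + 1)), Equiv.Perm.sign σ • H (v (σ 0)) (fun j => v (σ j.succ)) := by
  let e : Fin (n + 1) × Equiv.Perm (Fin n) → Equiv.Perm (Fin (n + 1)) := fun x =>
    x.1.cycleRange.symm * Equiv.Perm.decomposeFin.symm (0, x.2)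
  have e0 : ∀ x, e x 0 = x.1 := fun x => by simp [e]
  have es : ∀ x j, e x (Fin.succ j) = x.1.succAbove (x.2 j) := fun x j => by
    simp [e, Fin.cycleRange_symm_succ]
  have he : Function.Bijective e := by
    rw [Fintype.bijective_iff_injective_and_card]
    refine ⟨fun x y h => ?_, ?_⟩
    · have h1 : x.1 = y.1 := by rw [← e0, ← e0, h]
      refine Prod.ext h1 (Equiv.ext fun j => ?_)
      have h2 := es x j
      rw [h, es, h1] at h2
      exact (Fin.succAbove_right_injective h2).symm
    · simp [Fintype.card_perm, Nat.factorial_succ]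
  have esign : ∀ x, Equiv.Perm.sign (e x) = (-1) ^ (x.1 : ℕ) * Equiv.Perm.sign x.2 := fun x => by
    simp [e, Equiv.Perm.sign_mul, Fin.sign_cycleRange, Equiv.Perm.decomposeFin.symm_sign]
  rw [← (Equiv.ofBijective e he).sum_comp, Fintype.sum_prod_type]
  refine Finset.sum_congr rfl fun l _ => ?_
  rw [Finset.smul_sum]
  refine Finset.sum_congr rfl fun τ _ => ?_
  simp only [Equiv.ofBijective_apply, esign, e0, es, Fin.removeNth, mul_smul]
  simp [Units.smul_def]

/-- absorbing a permutation of part of the arguments -/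
lemma sum_absorb {N : ℕ} {G : Type*} [Group G] [Fintype G] (φ : G →* Equiv.Perm (Fin N))
    (Ψ : (Fin N → L) → W) (v : Fin N → L) :
    ∑ σ : Equiv.Perm (Fin N), Equiv.Perm.sign σ • ∑ ρ : G,
      Equiv.Perm.sign (φ ρ) • Ψ (fun i => v (σ (φ ρ i)))
    = Fintype.card G • ∑ σ : Equiv.Perm (Fin N), Equiv.Perm.sign σ • Ψ (fun i => v (σ i)) := by
  simp only [Finset.smul_sum]
  rw [Finset.sum_comm]
  have : ∀ ρ : G, ∑ σ : Equiv.Perm (Fin N), Equiv.Perm.sign σ • Equiv.Perm.sign (φ ρ) •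
      Ψ (fun i => v (σ (φ ρ i))) = ∑ σ : Equiv.Perm (Fin N), Equiv.Perm.sign σ •
        Ψ (fun i => v (σ i)) := fun ρ => by
    refine Fintype.sum_equiv (Equiv.mulRight (φ ρ)) _ _ fun σ => ?_
    simp [Equiv.Perm.sign_mul, mul_smul]
  simp only [this, Finset.sum_const, Finset.card_univ, Finset.smul_sum]

end Cup
section Leibniz

variable {k A L U W T : Type*} [Field k] [CharZero k] [CommRing A] [Algebra k A]
  [LieRing L] [LieAlgebra k L] [Module A L] [LieRingModule L A] [LieRinehartRing A L]
  [LieRinehartAlgebra k A L]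
  [AddCommGroup U] [Module k U] [Module A U] [IsScalarTower k A U]
  [AddCommGroup W] [Module k W] [Module A W] [IsScalarTower k A W]
  [AddCommGroup T] [Module k T] [Module A T] [IsScalarTower k A T]

lemma nsmul_cancel (k : Type*) [Field k] [CharZero k] [Module k T] {n : ℕ} (hn : n ≠ 0) {x y : T}
    (h : n • x = n • y) : x = y := by
  rw [← Nat.cast_smul_eq_nsmul k, ← Nat.cast_smul_eq_nsmul k n y] at h
  exact smul_right_injective T (Nat.cast_ne_zero.mpr hn) h

lemma covDeriv_apply (D : Connection k A L W) {n : ℕ} (ω : L [⋀^Fin n]→ₗ[A] W)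
    (v : Fin (n + 1) → L) :
    covDeriv D ω v = ∑ i : Fin (n + 1), (-1 : ℤ) ^ (i : ℕ) • lam D (v i) ω (i.removeNth v) :=
  koszul_eq_sum D ω v

lemma lam_perm (D : Connection k A L W) {n : ℕ} (ω : L [⋀^Fin n]→ₗ[A] W) (X : L) (x : Fin n → L)
    (τ : Equiv.Perm (Fin n)) :
    lam D X ω (fun j => x (τ j)) = Equiv.Perm.sign τ • lam D X ω x := by
  rw [← lamAlt_apply, ← lamAlt_apply]
  exact AlternatingMap.map_perm _ _ _

lemma sign_smul_sign_smul {n : ℕ} (τ : Equiv.Perm (Fin n)) (w : W) :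
    Equiv.Perm.sign τ • Equiv.Perm.sign τ • w = w := by
  rw [smul_smul, Int.units_mul_self, one_smul]

lemma factorial_smul_covDeriv (D : Connection k A L W) {n : ℕ} (ω : L [⋀^Fin n]→ₗ[A] W)
    (v : Fin (n + 1) → L) :
    n.factorial • covDeriv D ω v = ∑ σ : Equiv.Perm (Fin (n + 1)),
      Equiv.Perm.sign σ • lam D (v (σ 0)) ω (fun j => v (σ j.succ)) := by
  rw [← sum_removeNth (fun X x => lam D X ω x), covDeriv_apply, Finset.smul_sum]
  refine Finset.sum_congr rfl fun l _ => ?_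
  simp only [lam_perm, sign_smul_sign_smul, Finset.sum_const, Finset.card_univ, Fintype.card_perm,
    Fintype.card_fin]
  rw [smul_comm]

lemma lam_prod (DU : Connection k A L U) (DW : Connection k A L W) (DT : Connection k A L T)
    (μ : U →ₗ[A] W →ₗ[A] T)
    (hμ : ∀ X u w, DT.toLin X (μ u w) = μ (DU.toLin X u) w + μ u (DW.toLin X w))
    {p q : ℕ} (ω : L [⋀^Fin p]→ₗ[A] U) (η : L [⋀^Fin q]→ₗ[A] W) (X : L) (x : Fin (p + q) → L) :
    lam DT X (fun x => μ (ω fun i => x (Fin.castAdd q i)) (η fun j => x (Fin.natAdd p j))) x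
      = μ (lam DU X ω fun i => x (Fin.castAdd q i)) (η fun j => x (Fin.natAdd p j))
      + μ (ω fun i => x (Fin.castAdd q i)) (lam DW X η fun j => x (Fin.natAdd p j)) := by
  have h1 : ∀ i y, (fun i' => Function.update x (Fin.castAdd q i) y (Fin.castAdd q i'))
      = Function.update (fun i' => x (Fin.castAdd q i')) i y := fun i y =>
    Function.update_comp_eq_of_injective x (Fin.castAdd_injective p q) i y
  have h2 : ∀ i y, (fun j' => Function.update x (Fin.castAdd q i) y (Fin.natAdd p j'))
      = (fun j' => x (Fin.natAdd p j')) := fun i y => by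
    funext j'
    rw [Function.update_of_ne]
    intro h; have := congrArg Fin.val h; simp at this; omega
  have h3 : ∀ j y, (fun j' => Function.update x (Fin.natAdd p j) y (Fin.natAdd p j'))
      = Function.update (fun j' => x (Fin.natAdd p j')) j y := fun j y =>
    Function.update_comp_eq_of_injective x (Fin.natAdd_injective q p) j y
  have h4 : ∀ j y, (fun i' => Function.update x (Fin.natAdd p j) y (Fin.castAdd q i'))
      = (fun i' => x (Fin.castAdd q i')) := fun j y => by
    funext j'
    rw [Function.update_of_ne]
    intro h; have := congrArg Fin.val h; simp at this; omega
  have hk1 : ∀ (c : k) u w, μ (c • u) w = c • μ u w := fun c u w => by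
    rw [← algebraMap_smul A c u, map_smul, LinearMap.smul_apply, algebraMap_smul]
  have hk2 : ∀ (c : k) u w, μ u (c • w) = c • μ u w := fun c u w => by
    rw [← algebraMap_smul A c w, map_smul, algebraMap_smul]
  simp only [lam, hμ, Fin.sum_univ_add, h1, h2, h3, h4, map_sub, LinearMap.sub_apply, hk1, hk2,
    map_sum, LinearMap.sum_apply, smul_add]
  abel

lemma smul_covDeriv_cupWith (DU : Connection k A L U) (DW : Connection k A L W)
    (DT : Connection k A L T) (μ : U →ₗ[A] W →ₗ[A] T)
    (hμ : ∀ X u w, DT.toLin X (μ u w) = μ (DU.toLin X u) w + μ u (DW.toLin X w))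
    {p q : ℕ} (ω : L [⋀^Fin p]→ₗ[A] U) (η : L [⋀^Fin q]→ₗ[A] W) (v : Fin (p + q + 1) → L) :
    (p.factorial * q.factorial) • covDeriv DT (cupWith μ ω η) v
      = ∑ σ : Equiv.Perm (Fin (p + q + 1)), Equiv.Perm.sign σ •
          (μ (lam DU (v (σ 0)) ω fun i => v (σ (Fin.castAdd q i).succ))
            (η fun j => v (σ (Fin.natAdd p j).succ))
          + μ (ω fun i => v (σ (Fin.castAdd q i).succ))
            (lam DW (v (σ 0)) η fun j => v (σ (Fin.natAdd p j).succ))) := by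
  have hc := factorial_smul_cupWith μ ω η
  have key : ∀ X (x : Fin (p + q) → L), (p.factorial * q.factorial) • lam DT X (cupWith μ ω η) x
      = ∑ τ : Equiv.Perm (Fin (p + q)), Equiv.Perm.sign τ •
        (μ (lam DU X ω fun i => x (τ (Fin.castAdd q i))) (η fun j => x (τ (Fin.natAdd p j)))
        + μ (ω fun i => x (τ (Fin.castAdd q i)))
          (lam DW X η fun j => x (τ (Fin.natAdd p j)))) := by
    intro X x
    have e : ∀ τ : Equiv.Perm (Fin (p + q)), _ := fun τ =>
      lam_prod DU DW DT μ hμ ω η X (fun i => x (τ i))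
    simp only [← e]
    simp only [lam]
    rw [smul_sub, ← map_nsmul, hc, smul_comm _ (2⁻¹ : k), Finset.smul_sum]
    simp only [hc, map_sum, smul_sub, Finset.sum_sub_distrib]
    congr 1
    · refine Finset.sum_congr rfl fun τ _ => ?_
      rw [Units.smul_def, Units.smul_def, map_zsmul]
    · rw [Finset.sum_comm, Finset.smul_sum]
      refine Finset.sum_congr rfl fun τ _ => ?_
      rw [← Finset.smul_sum, smul_comm]
      congr 2
      refine Fintype.sum_equiv τ⁻¹ _ _ fun j => ?_
      have hu : ∀ i, Function.update x j ⁅X, x j⁆ (τ i)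
          = Function.update (fun i => x (τ i)) (τ⁻¹ j) ⁅X, x (τ (τ⁻¹ j))⁆ i := fun i => by
        by_cases h : τ i = j
        · subst h; simp
        · rw [Function.update_of_ne h, Function.update_of_ne]
          rintro rfl; simp at h
      simp only [hu]
  rw [covDeriv_apply, Finset.smul_sum, ← sum_removeNth (fun X x =>
    μ (lam DU X ω fun i => x (Fin.castAdd q i)) (η fun j => x (Fin.natAdd p j))
        + μ (ω fun i => x (Fin.castAdd q i))
          (lam DW X η fun j => x (Fin.natAdd p j)))]
  refine Finset.sum_congr rfl fun l _ => ?_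
  rw [smul_comm, key]

/-- permutations of the first block -/
def permLeft (p q : ℕ) : Equiv.Perm (Fin p) →* Equiv.Perm (Fin (p + q)) where
  toFun ρ := finSumFinEquiv.permCongr (Equiv.Perm.sumCongr ρ 1)
  map_one' := by ext i; simp [Equiv.permCongr_apply]
  map_mul' ρ ρ' := by
    rw [← Equiv.permCongr_mul, Equiv.Perm.sumCongr_mul, mul_one]

/-- permutations of the second block -/
def permRight (p q : ℕ) : Equiv.Perm (Fin q) →* Equiv.Perm (Fin (p + q)) where
  toFun ρ := finSumFinEquiv.permCongr (Equiv.Perm.sumCongr 1 ρ)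
  map_one' := by ext i; simp [Equiv.permCongr_apply]
  map_mul' ρ ρ' := by
    rw [← Equiv.permCongr_mul, Equiv.Perm.sumCongr_mul, mul_one]

lemma smul_cupWith_covDeriv_left (DU : Connection k A L U) (μ : U →ₗ[A] W →ₗ[A] T)
    {p q : ℕ} (ω : L [⋀^Fin p]→ₗ[A] U) (η : L [⋀^Fin q]→ₗ[A] W) (v : Fin (p + 1 + q) → L) :
    (p.factorial * q.factorial) • cupWith μ (covDeriv DU ω) η v
      = ∑ σ : Equiv.Perm (Fin (p + 1 + q)), Equiv.Perm.sign σ •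
          μ (lam DU (v (σ (Fin.castAdd q 0))) ω fun i => v (σ (Fin.castAdd q i.succ)))
            (η fun j => v (σ (Fin.natAdd (p + 1) j))) := by
  apply nsmul_cancel k (p + 1).factorial_ne_zero
  have h := congrArg (p.factorial • ·) (factorial_smul_cupWith μ (covDeriv DU ω) η v)
  have ha := sum_absorb (permLeft (p + 1) q) (fun x : Fin (p + 1 + q) → L =>
    μ (lam DU (x (Fin.castAdd q 0)) ω fun i => x (Fin.castAdd q i.succ))
            (η fun j => x (Fin.natAdd (p + 1) j))) v
  have s1 : ∀ ρ, Equiv.Perm.sign (permLeft (p + 1) q ρ) = Equiv.Perm.sign ρ := fun ρ => by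
    simp [permLeft]
  have s2 : ∀ ρ i, permLeft (p + 1) q ρ (Fin.castAdd q i) = Fin.castAdd q (ρ i) := fun ρ i => by
    simp [permLeft, Equiv.permCongr_apply]
  have s3 : ∀ ρ j, permLeft (p + 1) q ρ (Fin.natAdd (p + 1) j) = Fin.natAdd (p + 1) j :=
    fun ρ i => by simp [permLeft, Equiv.permCongr_apply]
  simp only [s1, s2, s3, Fintype.card_perm, Fintype.card_fin] at ha
  rw [← ha]
  have e : (p + 1).factorial • (p.factorial * q.factorial) • cupWith μ (covDeriv DU ω) η v
      = p.factorial • ((p + 1).factorial * q.factorial) • cupWith μ (covDeriv DU ω) η v := by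
    rw [smul_smul, smul_smul]; congr 1; ring
  rw [e]
  refine h.trans ?_
  rw [Finset.smul_sum]
  refine Finset.sum_congr rfl fun σ _ => ?_
  rw [smul_comm, ← LinearMap.smul_apply, ← map_nsmul, factorial_smul_covDeriv, map_sum,
    LinearMap.sum_apply]
  congr 1
  refine Finset.sum_congr rfl fun ρ _ => ?_
  simp only [Units.smul_def, map_zsmul, LinearMap.smul_apply]

lemma smul_cupWith_covDeriv_right (DW : Connection k A L W) (μ : U →ₗ[A] W →ₗ[A] T)
    {p q : ℕ} (ω : L [⋀^Fin p]→ₗ[A] U) (η : L [⋀^Fin q]→ₗ[A] W) (v : Fin (p + (q + 1)) → L) :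
    (p.factorial * q.factorial) • cupWith μ ω (covDeriv DW η) v
      = ∑ σ : Equiv.Perm (Fin (p + (q + 1))), Equiv.Perm.sign σ •
          μ (ω fun i => v (σ (Fin.castAdd (q + 1) i)))
            (lam DW (v (σ (Fin.natAdd p 0))) η fun j => v (σ (Fin.natAdd p j.succ))) := by
  have : CharZero k := inferInstance
  apply nsmul_cancel k (q + 1).factorial_ne_zero
  have h := congrArg (q.factorial • ·) (factorial_smul_cupWith μ ω (covDeriv DW η) v)
  have ha := sum_absorb (permRight p (q + 1)) (fun x : Fin (p + (q + 1)) → L =>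
    μ (ω fun i => x (Fin.castAdd (q + 1) i))
            (lam DW (x (Fin.natAdd p 0)) η fun j => x (Fin.natAdd p j.succ))) v
  have s1 : ∀ ρ, Equiv.Perm.sign (permRight p (q + 1) ρ) = Equiv.Perm.sign ρ := fun ρ => by
    simp [permRight]
  have s2 : ∀ ρ i, permRight p (q + 1) ρ (Fin.castAdd (q + 1) i) = Fin.castAdd (q + 1) i :=
    fun ρ i => by simp [permRight, Equiv.permCongr_apply]
  have s3 : ∀ ρ j, permRight p (q + 1) ρ (Fin.natAdd p j) = Fin.natAdd p (ρ j) :=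
    fun ρ i => by simp [permRight, Equiv.permCongr_apply]
  simp only [s1, s2, s3, Fintype.card_perm, Fintype.card_fin] at ha
  rw [← ha]
  have e : (q + 1).factorial • (p.factorial * q.factorial) • cupWith μ ω (covDeriv DW η) v
      = q.factorial • (p.factorial * (q + 1).factorial) • cupWith μ ω (covDeriv DW η) v := by
    rw [smul_smul, smul_smul]; congr 1; ring
  rw [e]
  refine h.trans ?_
  rw [Finset.smul_sum]
  refine Finset.sum_congr rfl fun σ _ => ?_
  rw [smul_comm, ← map_nsmul, factorial_smul_covDeriv, map_sum]
  congr 1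
  refine Finset.sum_congr rfl fun ρ _ => ?_
  simp only [Units.smul_def, map_zsmul]

/-- The Leibniz rule for the cup product. -/
theorem covDeriv_cupWith (DU : Connection k A L U) (DW : Connection k A L W)
    (DT : Connection k A L T) (μ : U →ₗ[A] W →ₗ[A] T)
    (hμ : ∀ X u w, DT.toLin X (μ u w) = μ (DU.toLin X u) w + μ u (DW.toLin X w))
    {p q : ℕ} (ω : L [⋀^Fin p]→ₗ[A] U) (η : L [⋀^Fin q]→ₗ[A] W) :
    covDeriv DT (cupWith μ ω η)
      = (cupWith μ (covDeriv DU ω) η).domDomCongr (finCongr (Nat.add_right_comm p 1 q))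
        + (-1 : ℤ) ^ p • cupWith μ ω (covDeriv DW η) := by
  ext v
  apply nsmul_cancel k (mul_ne_zero p.factorial_ne_zero q.factorial_ne_zero)
  rw [smul_covDeriv_cupWith DU DW DT μ hμ, AlternatingMap.add_apply, smul_add,
    AlternatingMap.smul_apply, smul_comm _ ((-1 : ℤ) ^ p), smul_cupWith_covDeriv_right,
    AlternatingMap.domDomCongr_apply, smul_cupWith_covDeriv_left]
  simp only [smul_add, Finset.sum_add_distrib]
  congr 1
  · refine (Fintype.sum_equiv (Equiv.permCongr (finCongr (Nat.add_right_comm p 1 q))) _ _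
      fun σ => ?_).symm
    rw [Equiv.Perm.sign_permCongr]
    have f0 : (finCongr (Nat.add_right_comm p 1 q)).symm 0 = Fin.castAdd q 0 := by
      ext; simp
    have f1 : ∀ i : Fin p, (finCongr (Nat.add_right_comm p 1 q)).symm (Fin.castAdd q i).succ
        = Fin.castAdd q i.succ := fun i => by ext; simp
    have f2 : ∀ j : Fin q, (finCongr (Nat.add_right_comm p 1 q)).symm (Fin.natAdd p j).succ
        = Fin.natAdd (p + 1) j := fun i => by ext; simp; omega
    simp only [Equiv.permCongr_apply, f0, f1, f2, Function.comp_apply]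
  · let c : Equiv.Perm (Fin (p + q + 1)) := (Fin.cycleRange ⟨p, by omega⟩).symm
    have hc0 : c 0 = Fin.natAdd p (0 : Fin (q + 1)) := by
      rw [Fin.cycleRange_symm_zero]; rfl
    have hc1 : ∀ i : Fin p, c (Fin.castAdd q i).succ = Fin.castAdd (q + 1) i := fun i => by
      rw [Fin.cycleRange_symm_succ, Fin.succAbove_of_castSucc_lt]
      · rfl
      · exact i.2
    have hc2 : ∀ j : Fin q, c (Fin.natAdd p j).succ = Fin.natAdd p j.succ := fun i => by
      rw [Fin.cycleRange_symm_succ, Fin.succAbove_of_le_castSucc]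
      · rfl
      · simp [Fin.le_def]
    have hs : Equiv.Perm.sign c = (-1) ^ p := by
      simp [c, Fin.sign_cycleRange]
    rw [Finset.smul_sum]
    refine Fintype.sum_equiv (Equiv.mulRight c⁻¹) _ _ fun σ => ?_
    simp only [← hc0, ← hc1, ← hc2, Equiv.coe_mulRight, Equiv.Perm.mul_apply,
      Equiv.Perm.inv_def, Equiv.symm_apply_apply, Equiv.Perm.sign_mul, Equiv.Perm.sign_symm, hs]
    rw [mul_comm, mul_smul]
    simp only [Units.smul_def, Units.val_pow_eq_pow_val, Units.val_neg, Units.val_one, smul_smul]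
    rw [← mul_assoc, ← mul_pow]
    simp

end Leibniz

section Natural

variable {k A L U W V : Type*} [Field k] [CharZero k] [CommRing A] [Algebra k A]
  [LieRing L] [LieAlgebra k L] [Module A L] [LieRingModule L A] [LieRinehartRing A L]
  [LieRinehartAlgebra k A L]
  [AddCommGroup U] [Module k U] [Module A U] [IsScalarTower k A U]
  [AddCommGroup W] [Module k W] [Module A W] [IsScalarTower k A W]
  [AddCommGroup V] [Module k V] [Module A V] [IsScalarTower k A V]

/-- A covariantly constant map commutes with the covariant derivatives. -/
lemma covDeriv_compAlternatingMap (DU : Connection k A L U) (DW : Connection k A L W)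
    (f : U →ₗ[A] W) (hf : ∀ X u, DW.toLin X (f u) = f (DU.toLin X u)) {n : ℕ}
    (ω : L [⋀^Fin n]→ₗ[A] U) :
    covDeriv DW (f.compAlternatingMap ω) = f.compAlternatingMap (covDeriv DU ω) := by
  have hk : ∀ (c : k) u, f (c • u) = c • f u := fun c u => by
    rw [← algebraMap_smul A c u, map_smul, algebraMap_smul]
  ext v
  simp only [covDeriv_apply, LinearMap.compAlternatingMap_apply, map_sum, map_zsmul, lam, map_sub,
    hk, hf]

/-- The second Bianchi identity. -/
theorem bianchi (D : Connection k A L V) : covDeriv D.onEnd (curvature D) = 0 := by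
  ext v w
  have j1 : ⁅⁅v 0, v 1⁆, v 2⁆ = ⁅v 0, ⁅v 1, v 2⁆⁆ - ⁅v 1, ⁅v 0, v 2⁆⁆ := lie_lie _ _ _
  have j2 : ⁅⁅v 0, v 2⁆, v 1⁆ = - ⁅v 1, ⁅v 0, v 2⁆⁆ := (lie_skew _ _).symm
  have j3 : ⁅⁅v 1, v 2⁆, v 0⁆ = - ⁅v 0, ⁅v 1, v 2⁆⁆ := (lie_skew _ _).symm
  have i0 : (Finset.Ici (0 : Fin 2)) = {0, 1} := by decide
  have i1 : (Finset.Ici (1 : Fin 2)) = {1} := by decide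
  have h : covDeriv D.onEnd (curvature D) v w = koszul D.onEnd (curvature D) v w := rfl
  rw [h]
  have p3 : (-1 : Module.End A V) ^ 3 = -1 := Odd.neg_one_pow (by decide)
  simp [-lie_lie, -lie_skew, koszul, koszulBracket, curvature, curvatureEnd, Connection.onEnd,
    Fin.sum_univ_succ, Fin.removeNth, i0, i1, Fin.succAbove, j1, j2, j3, p3]
  abel

end Natural

section Forms

open DirectSum

variable (A L W : Type*) [CommRing A] [AddCommGroup L] [Module A L] [AddCommGroup W] [Module A W]

/-- `W`-valued naive `n`-forms `Alt_Aⁿ(L, W)`. -/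
def NForm (n : ℕ) : Type _ := L [⋀^Fin n]→ₗ[A] W

instance (n : ℕ) : AddCommGroup (NForm A L W n) :=
  inferInstanceAs (AddCommGroup (L [⋀^Fin n]→ₗ[A] W))

instance (k : Type*) [Field k] [Module k W] [SMulCommClass A k W] (n : ℕ) :
    Module k (NForm A L W n) :=
  inferInstanceAs (Module k (L [⋀^Fin n]→ₗ[A] W))

/-- `W`-valued naive forms `Alt_A(L, W) = ⨁ₙ Alt_Aⁿ(L, W)`. -/
abbrev Forms := ⨁ n : ℕ, NForm A L W n

section FormOf

variable {A L W} (k : Type*) [Field k] [Module k W] [SMulCommClass A k W]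

/-- The inclusion of the `n`-forms. -/
noncomputable def formOf (n : ℕ) : (L [⋀^Fin n]→ₗ[A] W) →ₗ[k] Forms A L W where
  toFun ω := DirectSum.lof k ℕ (NForm A L W) n ω
  map_add' ω η := (DirectSum.lof k ℕ (NForm A L W) n).map_add ω η
  map_smul' c ω := (DirectSum.lof k ℕ (NForm A L W) n).map_smul c ω

/-- A linear map on forms from linear maps on the `n`-forms. -/
noncomputable def formLift {N : Type*} [AddCommGroup N] [Module k N]
    (g : ∀ n : ℕ, (L [⋀^Fin n]→ₗ[A] W) →ₗ[k] N) : Forms A L W →ₗ[k] N :=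
  DirectSum.toModule k ℕ N fun n =>
    { toFun := fun ω : NForm A L W n => g n ω
      map_add' := fun ω η => (g n).map_add ω η
      map_smul' := fun c ω => (g n).map_smul c ω }

variable {k}

@[simp]
lemma formLift_formOf {N : Type*} [AddCommGroup N] [Module k N]
    (g : ∀ n : ℕ, (L [⋀^Fin n]→ₗ[A] W) →ₗ[k] N) (n : ℕ) (ω : L [⋀^Fin n]→ₗ[A] W) :
    formLift k g (formOf k n ω) = g n ω :=
  DirectSum.toModule_lof k n _

lemma forms_ext {N : Type*} [AddCommGroup N] [Module k N] {f g : Forms A L W →ₗ[k] N}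
    (h : ∀ n (ω : L [⋀^Fin n]→ₗ[A] W), f (formOf k n ω) = g (formOf k n ω)) : f = g :=
  DirectSum.linearMap_ext k fun n => LinearMap.ext fun ω => h n ω

end FormOf

/-- Above the number of generators of `L` there are no nonzero forms. -/
theorem exists_forms_eq_zero [Module.Finite A L] :
    ∃ N : ℕ, ∀ n, N < n → ∀ ω : L [⋀^Fin n]→ₗ[A] W, ω = 0 := by
  obtain ⟨N, f, hf⟩ := Module.Finite.exists_fin' A L
  refine ⟨N, fun n hn ω => ?_⟩
  have h : ω.compLinearMap f = 0 := by
    refine Module.Basis.ext_alternating (Pi.basisFun A (Fin N)) fun v hv => ?_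
    have := Fintype.card_le_of_injective v hv
    simp at this
    omega
  ext v
  choose g hg using fun i => hf (v i)
  have := congrArg (fun η => η g) h
  simpa [Function.comp_def, hg] using this

end Forms

section DeRham

open DirectSum

variable {k A L U W V : Type*} [Field k] [CharZero k] [CommRing A] [Algebra k A]
  [LieRing L] [LieAlgebra k L] [Module A L] [LieRingModule L A] [LieRinehartRing A L]
  [LieRinehartAlgebra k A L]
  [AddCommGroup U] [Module k U] [Module A U] [IsScalarTower k A U]
  [AddCommGroup W] [Module k W] [Module A W] [IsScalarTower k A W]
  [AddCommGroup V] [Module k V] [Module A V] [IsScalarTower k A V]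

lemma covDeriv_add (D : Connection k A L W) {n : ℕ} (ω η : L [⋀^Fin n]→ₗ[A] W) :
    covDeriv D (ω + η) = covDeriv D ω + covDeriv D η := by
  ext v
  simp only [covDeriv_apply, AlternatingMap.add_apply, lam, map_add, ← Finset.sum_add_distrib,
    ← smul_add]
  refine Finset.sum_congr rfl fun i _ => ?_
  rw [Finset.sum_add_distrib, smul_add]
  congr 1
  abel

lemma covDeriv_smul (D : Connection k A L W) {n : ℕ} (c : k) (ω : L [⋀^Fin n]→ₗ[A] W) :
    covDeriv D (c • ω) = c • covDeriv D ω := by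
  ext v
  simp only [covDeriv_apply, AlternatingMap.smul_apply, lam, map_smul, Finset.smul_sum,
    smul_sub]
  refine Finset.sum_congr rfl fun i _ => ?_
  simp only [smul_comm c]

/-- The covariant derivative on all forms, raising the degree by one. -/
noncomputable def totalCovDeriv (D : Connection k A L W) : Forms A L W →ₗ[k] Forms A L W :=
  formLift k fun n => formOf k (n + 1) ∘ₗ
    { toFun := covDeriv D
      map_add' := covDeriv_add D
      map_smul' := covDeriv_smul D }

lemma totalCovDeriv_formOf (D : Connection k A L W) (n : ℕ) (ω : L [⋀^Fin n]→ₗ[A] W) :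
    totalCovDeriv D (formOf k n ω)
      = formOf k (n + 1) (covDeriv D ω) := by
  simp [totalCovDeriv]

variable (k) in
/-- The map on forms induced by an `A`-linear map of the values. -/
noncomputable def mapForms (f : U →ₗ[A] W) : Forms A L U →ₗ[k] Forms A L W :=
  formLift k fun n => formOf k n ∘ₗ
    { toFun := fun ω => f.compAlternatingMap ω
      map_add' := fun ω η => by ext; simp
      map_smul' := fun c ω => by
        ext v
        simp only [LinearMap.compAlternatingMap_apply, AlternatingMap.smul_apply,
          RingHom.id_apply]
        rw [← algebraMap_smul A c (ω v), map_smul, algebraMap_smul] }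

lemma mapForms_formOf (f : U →ₗ[A] W) (n : ℕ) (ω : L [⋀^Fin n]→ₗ[A] U) :
    mapForms k f (formOf k n ω)
      = formOf k n (f.compAlternatingMap ω) := by
  simp [mapForms]

lemma totalCovDeriv_mapForms (DU : Connection k A L U) (DW : Connection k A L W)
    (f : U →ₗ[A] W) (hf : ∀ X u, DW.toLin X (f u) = f (DU.toLin X u)) (x : Forms A L U) :
    totalCovDeriv DW (mapForms k f x) = mapForms k f (totalCovDeriv DU x) := by
  rw [← LinearMap.comp_apply, ← LinearMap.comp_apply]
  congr 1
  refine forms_ext fun n ω => ?_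
  simp only [LinearMap.comp_apply, totalCovDeriv_formOf, mapForms_formOf,
    covDeriv_compAlternatingMap DU DW f hf]

variable (k A L)

/-- The naive de Rham differential on `Alt_A(L, A)`. -/
noncomputable def dDR : Forms A L A →ₗ[k] Forms A L A :=
  totalCovDeriv (trivialConnection k A L)

/-- The cup product of forms. -/
noncomputable def cupForms : Forms A L A →ₗ[k] Forms A L A →ₗ[k] Forms A L A :=
  formLift k fun p =>
    (formLift k fun q =>
      ((LinearMap.mk₂ k (fun (ω : L [⋀^Fin p]→ₗ[A] A) (η : L [⋀^Fin q]→ₗ[A] A) =>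
          cupWith (LinearMap.mul A A) ω η)
        (fun ω ω' η => cupWith_add_left _ ω ω' η)
        (fun c ω η => by
          have : IsScalarTower k A (L [⋀^Fin p]→ₗ[A] A) := ⟨fun c a ω => by ext; simp⟩
          have : IsScalarTower k A (L [⋀^Fin (p + q)]→ₗ[A] A) := ⟨fun c a ω => by ext; simp⟩
          rw [← algebraMap_smul A c ω, cupWith_smul_left, algebraMap_smul])
        (fun ω η η' => cupWith_add_right _ ω η η')
        (fun c ω η => by
          have : IsScalarTower k A (L [⋀^Fin q]→ₗ[A] A) := ⟨fun c a ω => by ext; simp⟩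
          have : IsScalarTower k A (L [⋀^Fin (p + q)]→ₗ[A] A) := ⟨fun c a ω => by ext; simp⟩
          rw [← algebraMap_smul A c η, cupWith_smul_right, algebraMap_smul])).compr₂
        (formOf k (p + q))).flip).flip

variable {A L}

lemma cupForms_formOf {p q : ℕ} (ω : L [⋀^Fin p]→ₗ[A] A) (η : L [⋀^Fin q]→ₗ[A] A) :
    cupForms k A L (formOf k p ω)
      (formOf k q η)
      = formOf k (p + q)
          (cupWith (LinearMap.mul A A) ω η) := by
  simp [cupForms]

/-- multiplication by `(-1)ⁿ` on `n`-forms -/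
noncomputable def parity : Forms A L A →ₗ[k] Forms A L A :=
  formLift k fun n =>
    ((-1 : ℤ) ^ n) • formOf k n

lemma parity_formOf (n : ℕ) (ω : L [⋀^Fin n]→ₗ[A] A) :
    parity k (formOf k n ω)
      = ((-1 : ℤ) ^ n) • formOf k n ω := by
  simp [parity]

lemma parity_parity (x : Forms A L A) : parity k (parity k x) = x := by
  rw [← LinearMap.comp_apply]
  conv_rhs => rw [← LinearMap.id_apply (R := k) x]
  congr 1
  refine forms_ext fun n ω => ?_
  simp only [LinearMap.comp_apply, parity_formOf, map_zsmul, smul_smul, ← mul_pow]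
  simp

lemma dDR_parity (x : Forms A L A) : dDR k A L (parity k x) = - parity k (dDR k A L x) := by
  rw [← LinearMap.comp_apply, ← LinearMap.comp_apply, ← LinearMap.neg_apply]
  congr 1
  refine forms_ext fun n ω => ?_
  simp only [LinearMap.comp_apply, LinearMap.neg_apply, parity_formOf, map_zsmul, dDR,
    totalCovDeriv_formOf, pow_succ, mul_neg_one, neg_smul, neg_neg]

lemma formOf_domDomCongr {n n' : ℕ} (e : n = n') (ω : L [⋀^Fin n]→ₗ[A] A) :
    formOf k n' (ω.domDomCongr (finCongr e))
      = formOf k n ω := by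
  subst e
  rfl

/-- The Leibniz rule for the naive de Rham differential. -/
theorem dDR_cupForms (x y : Forms A L A) :
    dDR k A L (cupForms k A L x y)
      = cupForms k A L (dDR k A L x) y + cupForms k A L (parity k x) (dDR k A L y) := by
  have h : (cupForms k A L).compr₂ (dDR k A L) = (cupForms k A L).comp (dDR k A L)
      + (cupForms k A L).compl₁₂ (parity k) (dDR k A L) := by
    refine forms_ext fun p ω => ?_
    refine forms_ext fun q η => ?_
    simp only [LinearMap.comp_apply, LinearMap.compr₂_apply, LinearMap.add_apply,
      LinearMap.compl₁₂_apply, dDR, totalCovDeriv_formOf, parity_formOf, cupForms_formOf, map_zsmul,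
      LinearMap.smul_apply]
    rw [covDeriv_cupWith (trivialConnection k A L) (trivialConnection k A L)
      (trivialConnection k A L) (LinearMap.mul A A) (fun X a b => by
        simp [trivialConnection, mul_comm, add_comm])]
    rw [map_add, formOf_domDomCongr, map_zsmul]
    rfl
  exact congrArg (fun f => f x y) h

variable (A L)

/-- Closed forms. -/
noncomputable abbrev closedForms : Submodule k (Forms A L A) := LinearMap.ker (dDR k A L)

/-- Exact forms, as a subspace of the closed forms. -/
noncomputable abbrev exactForms : Submodule k (closedForms k A L) :=
  (LinearMap.range (dDR k A L)).submoduleOf (closedForms k A L)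

/-- The naive de Rham cohomology `H_dR(L, A)`. -/
abbrev HdR := closedForms k A L ⧸ exactForms k A L

/-- The cup product of closed forms. -/
noncomputable def cupClosed :
    closedForms k A L →ₗ[k] closedForms k A L →ₗ[k] closedForms k A L :=
  LinearMap.mk₂ k (fun x y => ⟨cupForms k A L x y, by
      rw [LinearMap.mem_ker, dDR_cupForms, LinearMap.mem_ker.mp x.2, LinearMap.mem_ker.mp y.2]
      simp⟩)
    (fun x x' y => Subtype.ext (by simp)) (fun c x y => Subtype.ext (by simp))
    (fun x y y' => Subtype.ext (by simp)) (fun c x y => Subtype.ext (by simp))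

lemma cupClosed_exact_right (x y : closedForms k A L) (hy : y ∈ exactForms k A L) :
    cupClosed k A L x y ∈ exactForms k A L := by
  obtain ⟨b, hb⟩ := hy
  refine ⟨cupForms k A L (parity k x) b, ?_⟩
  rw [dDR_cupForms, dDR_parity, LinearMap.mem_ker.mp x.2, parity_parity, hb]
  simp [cupClosed]

lemma cupClosed_exact_left (x y : closedForms k A L) (hx : x ∈ exactForms k A L) :
    cupClosed k A L x y ∈ exactForms k A L := by
  obtain ⟨a, ha⟩ := hx
  refine ⟨cupForms k A L a y, ?_⟩
  rw [dDR_cupForms, LinearMap.mem_ker.mp y.2, ha]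
  simp [cupClosed]

/-- The cup product on cohomology, `[x] ∪ [y] = [x ∪ y]`. -/
noncomputable def HdR.cup : HdR k A L →ₗ[k] HdR k A L →ₗ[k] HdR k A L :=
  (exactForms k A L).liftQ
    ((exactForms k A L).liftQ ((cupClosed k A L).compr₂ (exactForms k A L).mkQ).flip
      (fun y hy => by
        rw [LinearMap.mem_ker]
        ext x
        exact (Submodule.Quotient.mk_eq_zero _).mpr (cupClosed_exact_right k A L x y hy))).flip
    (fun x hx => by
      rw [LinearMap.mem_ker]
      refine Submodule.linearMap_qext _ (LinearMap.ext fun y => ?_)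
      exact (Submodule.Quotient.mk_eq_zero _).mpr (cupClosed_exact_left k A L x y hx))

theorem HdR.cup_mk (x y : closedForms k A L) :
    HdR.cup k A L (Submodule.Quotient.mk x) (Submodule.Quotient.mk y)
      = Submodule.Quotient.mk (cupClosed k A L x y) := rfl

end DeRham

section Chern

open DirectSum

variable {k A L V : Type*} [Field k] [CharZero k] [CommRing A] [Algebra k A]
  [LieRing L] [LieAlgebra k L] [Module A L] [LieRingModule L A] [LieRinehartRing A L]
  [LieRinehartAlgebra k A L]
  [AddCommGroup V] [Module k V] [Module A V] [IsScalarTower k A V]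

/-- The powers `R^m` of the curvature endomorphism for the cup product of `End_A(V)`-valued
forms. -/
def curvaturePow (D : Connection k A L V) : (m : ℕ) → L [⋀^Fin (2 * m)]→ₗ[A] Module.End A V
  | 0 => AlternatingMap.constOfIsEmpty A L (Fin 0) 1
  | m + 1 => cupWith (LinearMap.mul A (Module.End A V)) (curvaturePow D m) (curvature D)

/-- `exp(κ R) = ∑ κ^m / m! R^m`. If `L` is finitely generated, only finitely many summands are
nonzero, see `finite_support_exp`. -/
noncomputable def expCurvature (κ : k) (D : Connection k A L V) : Forms A L (Module.End A V) :=
  ∑ᶠ m : ℕ, (κ ^ m / (m.factorial : k)) •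
    formOf k (2 * m) (curvaturePow D m)

theorem finite_support_exp [Module.Finite A L] (κ : k) (D : Connection k A L V) :
    (Function.support fun m : ℕ => (κ ^ m / (m.factorial : k)) •
      formOf k (2 * m)
        (curvaturePow D m)).Finite := by
  obtain ⟨N, hN⟩ := exists_forms_eq_zero A L (Module.End A V)
  refine (Set.finite_Iic N).subset fun m hm => ?_
  by_contra h
  exact hm (by simp only [hN (2 * m) (by simp at h; omega) (curvaturePow D m), map_zero, smul_zero])

lemma onEnd_mul (D : Connection k A L V) (X : L) (φ ψ : Module.End A V) :
    D.onEnd.toLin X (LinearMap.mul A (Module.End A V) φ ψ)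
      = LinearMap.mul A (Module.End A V) (D.onEnd.toLin X φ) ψ
        + LinearMap.mul A (Module.End A V) φ (D.onEnd.toLin X ψ) := by
  ext v
  simp [Connection.onEnd]

lemma covDeriv_curvaturePow (D : Connection k A L V) (m : ℕ) :
    covDeriv D.onEnd (curvaturePow D m) = 0 := by
  induction m with
  | zero =>
    ext v w
    rw [covDeriv_apply]
    simp [curvaturePow, lam, Connection.onEnd]
  | succ m ih =>
    refine (covDeriv_cupWith D.onEnd D.onEnd D.onEnd _ (onEnd_mul D)
      (curvaturePow D m) (curvature D)).trans ?_
    have h1 := cupWith_smul_left (LinearMap.mul A (Module.End A V)) (0 : A)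
      (0 : L [⋀^Fin (2 * m + 1)]→ₗ[A] Module.End A V) (curvature D)
    have h2 := cupWith_smul_right (LinearMap.mul A (Module.End A V)) (0 : A)
      (curvaturePow D m) (0 : L [⋀^Fin 3]→ₗ[A] Module.End A V)
    rw [zero_smul, zero_smul] at h1 h2
    rw [ih, bianchi, h1, h2, smul_zero, add_zero, AlternatingMap.domDomCongr_zero]

variable [Module.Finite A V] [Module.Projective A V]

/-- `trace_V(exp(κ R))`. -/
noncomputable def chernForm (κ : k) (D : Connection k A L V) : Forms A L A :=
  mapForms k (projTrace A V) (expCurvature κ D)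

theorem chernForm_closed (κ : k) (D : Connection k A L V) :
    chernForm κ D ∈ closedForms k A L := by
  rw [LinearMap.mem_ker, chernForm, dDR, totalCovDeriv_mapForms D.onEnd (trivialConnection k A L)
    (projTrace A V) (fun X φ => (projTrace_onEnd D X φ).symm)]
  have : totalCovDeriv D.onEnd (expCurvature κ D) = 0 := by
    rw [← LinearMap.mem_ker, expCurvature]
    refine finsum_induction (· ∈ LinearMap.ker (totalCovDeriv D.onEnd)) (Submodule.zero_mem _)
      (fun x y => Submodule.add_mem _) fun m => Submodule.smul_mem _ _ ?_
    rw [LinearMap.mem_ker, totalCovDeriv_formOf, covDeriv_curvaturePow, map_zero]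
  rw [this, map_zero]

/-- The class `[trace_V(exp(κ R))]`, for the curvature `R` of the connection `D` on `V`. -/
noncomputable def chernClass (κ : k) (D : Connection k A L V) : HdR k A L :=
  Submodule.Quotient.mk ⟨chernForm κ D, chernForm_closed κ D⟩

variable (k A L V) in
/-- The Chern character `ch_κ(V) = [trace_V(exp(κ R))]`, where `R` is the curvature of some
connection on `V`. -/
noncomputable def chernCharacter (κ : k) : HdR k A L :=
  chernClass κ (Connection.nonempty_of_projective (k := k) (A := A) (L := L) (V := V)).some

end Chern


end LieRinehart

/-!
The proof takes place in the algebra `Ω(E) = Forms A L E` of forms with values in an `A`-algebra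
`E`, with the cup product as multiplication. That this is an associative graded algebra is not
visible in the definition by shuffles; `cupWith_assoc` and `cupWith_flip` (graded commutativity)
are deduced from the description of the cup product as an antisymmetrisation over all permutations,
divided by factorials. This needs `A` to be a `ℚ`-algebra, which it is as an algebra over a field
of characteristic zero. A connection on `V` makes `Ω(End V)` an algebra with an odd derivation `d`
(`totalCovDeriv_mul`), the trace is a graded trace `τ` intertwining `d` with the de Rham
differential, and the Chern form is `τ(exp(κ R))` for the curvature `R`, an element of degree two.

*Independence of the connection.* If `B` is the difference of two connections, a one-form, then
`R' = R + dB + B²` and `d' = d + [B, ·]`. Along the family `R_t = R + t dB + t² B²` with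
`d_t = d + t [B, ·]` one has `d_t R_t = 0` and `∂R_t/∂t = d_t B`, so
`∂/∂t τ(R_t^m) = m τ(R_t^(m-1) d_t B)` is the differential of `m τ(R_t^(m-1) B)`; integration over
`0 ≤ t ≤ 1` shows that `τ(R'^m) - τ(R^m)` is exact. The argument is purely algebraic and is
carried out in `Ω[t] = Ω ⊗ k[t]`, see `transgression`; the identity `d² B = [R, B]` that it
needs follows from the Bianchi identities for both connections.

*Sum and product.* By the independence, any connection may be used on `V × V'` and `V ⊗ V'`. For
the direct sum of two connections the curvature is block diagonal (`curvature_prod`) and the Chern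
forms add up. For the tensor product of two connections the curvature is `R ⊗ 1 + 1 ⊗ R'`
(`curvature_tensor`), a sum of two commuting nilpotent elements, so its exponential is the product
of `exp(κ R) ⊗ 1` and `1 ⊗ exp(κ R')`, and the trace of `φ ⊗ ψ` is the product of the traces
(`projTrace_rTensor_mul_lTensor`).
-/

namespace LieRinehart

/-! ### Algebra of the cup product -/

section CupAlgebra

variable {A L U U' W W' T T' Z S : Type*} [CommRing A] [AddCommGroup L] [Module A L]
  [AddCommGroup U] [Module A U] [AddCommGroup U'] [Module A U']
  [AddCommGroup W] [Module A W] [AddCommGroup W'] [Module A W']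
  [AddCommGroup T] [Module A T] [AddCommGroup T'] [Module A T'] [AddCommGroup Z] [Module A Z]
  [AddCommGroup S] [Module A S]

lemma nsmul_cancel_of_algebra_rat (A : Type*) [CommRing A] [Algebra ℚ A] [Module A T] {n : ℕ}
    (hn : n ≠ 0) {x y : T} (h : n • x = n • y) : x = y :=
  letI : Module ℚ T := Module.compHom T (algebraMap ℚ A)
  nsmul_cancel ℚ hn h

lemma sign_permLeft {p q : ℕ} (ρ : Equiv.Perm (Fin p)) :
    Equiv.Perm.sign (permLeft p q ρ) = Equiv.Perm.sign ρ := by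
  simp [permLeft]

lemma permLeft_castAdd {p q : ℕ} (ρ : Equiv.Perm (Fin p)) (i : Fin p) :
    permLeft p q ρ (Fin.castAdd q i) = Fin.castAdd q (ρ i) := by
  simp [permLeft, Equiv.permCongr_apply]

lemma permLeft_natAdd {p q : ℕ} (ρ : Equiv.Perm (Fin p)) (j : Fin q) :
    permLeft p q ρ (Fin.natAdd p j) = Fin.natAdd p j := by
  simp [permLeft, Equiv.permCongr_apply]

lemma sign_permRight {p q : ℕ} (ρ : Equiv.Perm (Fin q)) :
    Equiv.Perm.sign (permRight p q ρ) = Equiv.Perm.sign ρ := by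
  simp [permRight]

lemma permRight_castAdd {p q : ℕ} (ρ : Equiv.Perm (Fin q)) (i : Fin p) :
    permRight p q ρ (Fin.castAdd q i) = Fin.castAdd q i := by
  simp [permRight, Equiv.permCongr_apply]

lemma permRight_natAdd {p q : ℕ} (ρ : Equiv.Perm (Fin q)) (j : Fin q) :
    permRight p q ρ (Fin.natAdd p j) = Fin.natAdd p (ρ j) := by
  simp [permRight, Equiv.permCongr_apply]

/-- A triple cup product, bracketed to the left, is an antisymmetrisation over all
permutations. -/
lemma factorial_smul_cupWith_cupWith_left [Algebra ℚ A] (μ : U →ₗ[A] W →ₗ[A] T)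
    (ν : T →ₗ[A] Z →ₗ[A] S) {p q r : ℕ} (ω : L [⋀^Fin p]→ₗ[A] U) (η : L [⋀^Fin q]→ₗ[A] W)
    (ζ : L [⋀^Fin r]→ₗ[A] Z) (v : Fin (p + q + r) → L) :
    (p.factorial * q.factorial * r.factorial) • cupWith ν (cupWith μ ω η) ζ v
      = ∑ σ : Equiv.Perm (Fin (p + q + r)), Equiv.Perm.sign σ •
        ν (μ (ω fun i => v (σ (Fin.castAdd r (Fin.castAdd q i))))
          (η fun j => v (σ (Fin.castAdd r (Fin.natAdd p j)))))
          (ζ fun l => v (σ (Fin.natAdd (p + q) l))) := by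
  apply nsmul_cancel_of_algebra_rat A (p + q).factorial_ne_zero
  have ha := sum_absorb (permLeft (p + q) r) (fun x : Fin (p + q + r) → L =>
    ν (μ (ω fun i => x (Fin.castAdd r (Fin.castAdd q i)))
          (η fun j => x (Fin.castAdd r (Fin.natAdd p j))))
          (ζ fun l => x (Fin.natAdd (p + q) l))) v
  simp only [sign_permLeft, permLeft_castAdd, permLeft_natAdd, Fintype.card_perm,
    Fintype.card_fin] at ha
  rw [← ha, smul_smul, show (p + q).factorial * (p.factorial * q.factorial * r.factorial)
    = (p.factorial * q.factorial) * ((p + q).factorial * r.factorial) by ring, ← smul_smul,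
    factorial_smul_cupWith, Finset.smul_sum]
  refine Finset.sum_congr rfl fun σ _ => ?_
  rw [smul_comm, ← LinearMap.smul_apply, ← map_nsmul, factorial_smul_cupWith, map_sum,
    LinearMap.sum_apply]
  congr 1
  refine Finset.sum_congr rfl fun ρ _ => ?_
  simp only [Units.smul_def, map_zsmul, LinearMap.smul_apply]

/-- A triple cup product, bracketed to the right, is an antisymmetrisation over all
permutations. -/
lemma factorial_smul_cupWith_cupWith_right [Algebra ℚ A] (μ : U →ₗ[A] T →ₗ[A] S)
    (ν : W →ₗ[A] Z →ₗ[A] T) {p q r : ℕ} (ω : L [⋀^Fin p]→ₗ[A] U) (η : L [⋀^Fin q]→ₗ[A] W)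
    (ζ : L [⋀^Fin r]→ₗ[A] Z) (v : Fin (p + (q + r)) → L) :
    (p.factorial * q.factorial * r.factorial) • cupWith μ ω (cupWith ν η ζ) v
      = ∑ σ : Equiv.Perm (Fin (p + (q + r))), Equiv.Perm.sign σ •
        μ (ω fun i => v (σ (Fin.castAdd (q + r) i)))
          (ν (η fun j => v (σ (Fin.natAdd p (Fin.castAdd r j))))
          (ζ fun l => v (σ (Fin.natAdd p (Fin.natAdd q l))))) := by
  apply nsmul_cancel_of_algebra_rat A (q + r).factorial_ne_zero
  have ha := sum_absorb (permRight p (q + r)) (fun x : Fin (p + (q + r)) → L =>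
    μ (ω fun i => x (Fin.castAdd (q + r) i))
          (ν (η fun j => x (Fin.natAdd p (Fin.castAdd r j)))
          (ζ fun l => x (Fin.natAdd p (Fin.natAdd q l))))) v
  simp only [sign_permRight, permRight_castAdd, permRight_natAdd, Fintype.card_perm,
    Fintype.card_fin] at ha
  rw [← ha, smul_smul, show (q + r).factorial * (p.factorial * q.factorial * r.factorial)
    = (q.factorial * r.factorial) * (p.factorial * (q + r).factorial) by ring, ← smul_smul,
    factorial_smul_cupWith, Finset.smul_sum]
  refine Finset.sum_congr rfl fun σ _ => ?_
  rw [smul_comm, ← map_nsmul, factorial_smul_cupWith, map_sum]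
  congr 1
  refine Finset.sum_congr rfl fun ρ _ => ?_
  simp only [Units.smul_def, map_zsmul]

/-- Associativity of the cup product, for bilinear maps satisfying `(u w) z = u (w z)`. -/
theorem cupWith_assoc [Algebra ℚ A] (μ : U →ₗ[A] W →ₗ[A] T) (ν : T →ₗ[A] Z →ₗ[A] S)
    (μ' : U →ₗ[A] T' →ₗ[A] S) (ν' : W →ₗ[A] Z →ₗ[A] T')
    (h : ∀ u w z, ν (μ u w) z = μ' u (ν' w z)) {p q r : ℕ} (ω : L [⋀^Fin p]→ₗ[A] U)
    (η : L [⋀^Fin q]→ₗ[A] W) (ζ : L [⋀^Fin r]→ₗ[A] Z) :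
    (cupWith ν (cupWith μ ω η) ζ).domDomCongr (finCongr (Nat.add_assoc p q r))
      = cupWith μ' ω (cupWith ν' η ζ) := by
  ext v
  apply nsmul_cancel_of_algebra_rat A
    (mul_ne_zero (mul_ne_zero p.factorial_ne_zero q.factorial_ne_zero) r.factorial_ne_zero)
  rw [AlternatingMap.domDomCongr_apply, factorial_smul_cupWith_cupWith_left,
    factorial_smul_cupWith_cupWith_right]
  refine Fintype.sum_equiv (Equiv.permCongr (finCongr (Nat.add_assoc p q r))) _ _ fun σ => ?_
  have f0 : ∀ i : Fin p, (finCongr (Nat.add_assoc p q r)).symm (Fin.castAdd (q + r) i)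
      = Fin.castAdd r (Fin.castAdd q i) := fun i => by ext; simp
  have f1 : ∀ j : Fin q, (finCongr (Nat.add_assoc p q r)).symm (Fin.natAdd p (Fin.castAdd r j))
      = Fin.castAdd r (Fin.natAdd p j) := fun i => by ext; simp
  have f2 : ∀ l : Fin r, (finCongr (Nat.add_assoc p q r)).symm (Fin.natAdd p (Fin.natAdd q l))
      = Fin.natAdd (p + q) l := fun i => by ext; simp; omega
  rw [Equiv.Perm.sign_permCongr]
  simp only [Equiv.permCongr_apply, f0, f1, f2, Function.comp_apply, h]

lemma finRotate_pow_apply {n : ℕ} (m : ℕ) (i : Fin n) :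
    (((finRotate n) ^ m) i : ℕ) = (i + m) % n := by
  cases n with
  | zero => exact i.elim0
  | succ n =>
    induction m with
    | zero => simp [Nat.mod_eq_of_lt i.2]
    | succ m ih =>
      rw [pow_succ', Equiv.Perm.mul_apply, finRotate_apply, Fin.val_add, ih]
      simp [Nat.add_mod, ← Nat.add_assoc]

/-- The permutation exchanging the two blocks of arguments has sign `(-1)^(p q)`. -/
lemma exists_perm_swap_blocks (p q : ℕ) : ∃ c : Equiv.Perm (Fin (p + q)),
    Equiv.Perm.sign c = (-1) ^ (p * q) ∧
    (∀ i : Fin p, c (Fin.cast (Nat.add_comm q p) (Fin.natAdd q i)) = Fin.castAdd q i) ∧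
    (∀ j : Fin q, c (Fin.cast (Nat.add_comm q p) (Fin.castAdd p j)) = Fin.natAdd p j) := by
  -- The block swap is the `p`-th power of the cyclic rotation of all `p + q` positions.
  refine ⟨finRotate (p + q) ^ p, ?_, fun i => Fin.ext ?_, fun j => Fin.ext ?_⟩
  · rw [map_pow, sign_finRotate, ← pow_mul]
    cases p with
    | zero => simp
    | succ p =>
      rw [show (p + 1 + q - 1) * (p + 1) = p * (p + 1) + (p + 1) * q by
        rw [show p + 1 + q - 1 = p + q by omega]; ring, pow_add,
        (Nat.even_mul_succ_self p).neg_one_pow, one_mul]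
  · have := i.2
    rw [finRotate_pow_apply, Fin.val_cast, Fin.val_natAdd, Fin.val_castAdd,
      show q + (i : ℕ) + p = i + (p + q) by omega, Nat.add_mod_right, Nat.mod_eq_of_lt (by omega)]
  · have := j.2
    rw [finRotate_pow_apply, Fin.val_cast, Fin.val_castAdd, Fin.val_natAdd,
      Nat.mod_eq_of_lt (by omega), Nat.add_comm]

/-- Graded commutativity of the cup product. -/
theorem cupWith_flip [Algebra ℚ A] (μ : U →ₗ[A] W →ₗ[A] T) {p q : ℕ}
    (ω : L [⋀^Fin p]→ₗ[A] U) (η : L [⋀^Fin q]→ₗ[A] W) :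
    (cupWith μ.flip η ω).domDomCongr (finCongr (Nat.add_comm q p))
      = (-1 : ℤ) ^ (p * q) • cupWith μ ω η := by
  -- Both sides are sums over all permutations, matched by composition with the block swap.
  obtain ⟨c, hs, hc0, hc1⟩ := exists_perm_swap_blocks p q
  ext v
  apply nsmul_cancel_of_algebra_rat A (mul_ne_zero p.factorial_ne_zero q.factorial_ne_zero)
  rw [AlternatingMap.smul_apply, smul_comm, factorial_smul_cupWith, mul_comm p.factorial,
    AlternatingMap.domDomCongr_apply, factorial_smul_cupWith, Finset.smul_sum]
  refine (Fintype.sum_equiv (Equiv.permCongr (finCongr (Nat.add_comm q p))) _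
    (fun σ : Equiv.Perm (Fin (p + q)) => Equiv.Perm.sign σ •
      μ (ω fun i => v (σ (Fin.cast (Nat.add_comm q p) (Fin.natAdd q i))))
        (η fun j => v (σ (Fin.cast (Nat.add_comm q p) (Fin.castAdd p j))))) fun σ => ?_).trans ?_
  · rw [Equiv.Perm.sign_permCongr]
    rfl
  · refine (Fintype.sum_equiv (Equiv.mulRight c) _ _ fun σ => ?_).symm
    simp only [Equiv.coe_mulRight, Equiv.Perm.mul_apply, hc0, hc1, Equiv.Perm.sign_mul, hs]
    rw [mul_comm (Equiv.Perm.sign σ), mul_smul]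
    simp only [Units.smul_def, Units.val_pow_eq_pow_val, Units.val_neg, Units.val_one]

/-- Naturality of the cup product in the coefficients. -/
lemma compAlternatingMap_cupWith [Algebra ℚ A] (μ : U →ₗ[A] W →ₗ[A] T)
    (μ' : U' →ₗ[A] W' →ₗ[A] T') (f : U →ₗ[A] U') (g : W →ₗ[A] W') (h : T →ₗ[A] T')
    (hh : ∀ u w, h (μ u w) = μ' (f u) (g w)) {p q : ℕ}
    (ω : L [⋀^Fin p]→ₗ[A] U) (η : L [⋀^Fin q]→ₗ[A] W) :
    h.compAlternatingMap (cupWith μ ω η)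
      = cupWith μ' (f.compAlternatingMap ω) (g.compAlternatingMap η) := by
  ext v
  apply nsmul_cancel_of_algebra_rat A (mul_ne_zero p.factorial_ne_zero q.factorial_ne_zero)
  rw [LinearMap.compAlternatingMap_apply, ← map_nsmul, factorial_smul_cupWith,
    factorial_smul_cupWith, map_sum]
  simp only [Units.smul_def, map_zsmul, hh, LinearMap.compAlternatingMap_apply]

/-- Cup products with a form of degree zero on the left. -/
lemma cupWith_zero_left [Algebra ℚ A] (μ : U →ₗ[A] W →ₗ[A] T) {q : ℕ} (u : U)
    (η : L [⋀^Fin q]→ₗ[A] W) :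
    (cupWith μ (AlternatingMap.constOfIsEmpty A L (Fin 0) u) η).domDomCongr
      (finCongr (Nat.zero_add q)) = (μ u).compAlternatingMap η := by
  ext v
  apply nsmul_cancel_of_algebra_rat A
    (mul_ne_zero (Nat.factorial_ne_zero 0) q.factorial_ne_zero)
  rw [AlternatingMap.domDomCongr_apply, factorial_smul_cupWith]
  have : ∀ σ : Equiv.Perm (Fin (0 + q)),
      (η fun j => (v ∘ finCongr (Nat.zero_add q)) (σ (Fin.natAdd 0 j)))
      = Equiv.Perm.sign σ • η v := fun σ => by
    rw [← Equiv.Perm.sign_permCongr (finCongr (Nat.zero_add q)), ← AlternatingMap.map_perm]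
    congr 1
    funext j
    simp only [Function.comp_apply, Equiv.permCongr_apply]
    congr 3
    ext
    simp
  simp only [this]
  simp [Units.smul_def, smul_smul, Fintype.card_perm]

/-- The cup product of a one-form with an `n`-form, as an alternating sum. -/
lemma cupWith_one_apply [Algebra ℚ A] (μ : U →ₗ[A] W →ₗ[A] T) {n : ℕ}
    (β : L [⋀^Fin 1]→ₗ[A] U) (ω : L [⋀^Fin n]→ₗ[A] W) (v : Fin (n + 1) → L) :
    cupWith μ β ω (v ∘ finCongr (Nat.add_comm 1 n))
      = ∑ i : Fin (n + 1), (-1 : ℤ) ^ (i : ℕ) • μ (β fun _ => v i) (ω (i.removeNth v)) := by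
  apply nsmul_cancel_of_algebra_rat A
    (mul_ne_zero (Nat.factorial_ne_zero 1) n.factorial_ne_zero)
  rw [factorial_smul_cupWith]
  refine (Fintype.sum_equiv (Equiv.permCongr (finCongr (Nat.add_comm 1 n))) _
    (fun σ : Equiv.Perm (Fin (n + 1)) => Equiv.Perm.sign σ •
      μ (β fun _ => v (σ 0)) (ω fun j => v (σ j.succ))) fun σ => ?_).trans ?_
  · rw [Equiv.Perm.sign_permCongr]
    have f0 : ∀ i : Fin 1, (finCongr (Nat.add_comm 1 n)).symm 0 = Fin.castAdd n i := fun i => by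
      ext; simp
    have f1 : ∀ j : Fin n, (finCongr (Nat.add_comm 1 n)).symm j.succ = Fin.natAdd 1 j :=
      fun i => by ext; simp [Nat.add_comm]
    simp only [Equiv.permCongr_apply, f1, Function.comp_apply]
    congr 3
    refine congrArg β (funext fun i => ?_)
    rw [f0 i]
  · rw [← sum_removeNth (fun X x => μ (β fun _ => X) (ω x)), Finset.smul_sum]
    refine Finset.sum_congr rfl fun l _ => ?_
    have : ∀ τ : Equiv.Perm (Fin n), (ω fun j => l.removeNth v (τ j))
        = Equiv.Perm.sign τ • ω (l.removeNth v) := fun τ => ω.map_perm (l.removeNth v) τ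
    simp only [this, Units.smul_def, map_zsmul, smul_smul]
    simp [Fintype.card_perm, smul_comm n.factorial]

end CupAlgebra

/-! ### The graded algebra of forms with values in an algebra -/

section FormAlgebra

open DirectSum

variable {A L E : Type*} [CommRing A] [AddCommGroup L] [Module A L] [Ring E] [Algebra A E]

/-- Transporting a form along an equality of degrees does not change the graded element. -/
lemma gradedMonoid_mk_domDomCongr {n n' : ℕ} (e : n = n') (ω : L [⋀^Fin n]→ₗ[A] E) :
    (GradedMonoid.mk n' (ω.domDomCongr (finCongr e) : NForm A L E n') : GradedMonoid (NForm A L E))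
      = GradedMonoid.mk n (ω : NForm A L E n) := by
  subst e
  rfl

lemma cupWith_zero_right [Algebra ℚ A] {p : ℕ} (ω : L [⋀^Fin p]→ₗ[A] E) (x : E) :
    cupWith (LinearMap.mul A E) ω (AlternatingMap.constOfIsEmpty A L (Fin 0) x)
      = ((LinearMap.mul A E).flip x).compAlternatingMap ω := by
  have h := cupWith_flip (LinearMap.mul A E) ω (AlternatingMap.constOfIsEmpty A L (Fin 0) x)
  rw [mul_zero, pow_zero, one_smul] at h
  rw [← h, ← cupWith_zero_left]

/-- The unit is the constant form `1` of degree zero. -/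
instance : GradedMonoid.GOne (NForm A L E) where
  one := AlternatingMap.constOfIsEmpty A L (Fin 0) 1

/-- The cup product of forms with values in an `A`-algebra. -/
instance : GradedMonoid.GMul (NForm A L E) where
  mul ω η := cupWith (LinearMap.mul A E) ω η

/-- Forms with values in an `A`-algebra are a graded ring for the cup product. The `ℚ`-algebra
structure of `A` is used only to divide by factorials in the proofs of the axioms. -/
instance [Algebra ℚ A] : GRing (NForm A L E) where
  mul_zero {i j} ω := by
    have h := cupWith_smul_right (LinearMap.mul A E) (0 : A) ω (0 : L [⋀^Fin j]→ₗ[A] E)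
    rwa [zero_smul, zero_smul] at h
  zero_mul {i j} η := by
    have h := cupWith_smul_left (LinearMap.mul A E) (0 : A) (0 : L [⋀^Fin i]→ₗ[A] E) η
    rwa [zero_smul, zero_smul] at h
  mul_add := cupWith_add_right _
  add_mul := cupWith_add_left _
  one_mul ω := by
    refine (gradedMonoid_mk_domDomCongr (Nat.zero_add _) _).symm.trans ?_
    refine congrArg (GradedMonoid.mk _) ((cupWith_zero_left _ _ _).trans ?_)
    exact AlternatingMap.ext fun v => one_mul _
  mul_one ω := by
    refine congrArg (GradedMonoid.mk _) ((cupWith_zero_right _ _).trans ?_)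
    exact AlternatingMap.ext fun v => mul_one _
  mul_assoc ω η ζ := by
    refine (gradedMonoid_mk_domDomCongr (Nat.add_assoc _ _ _) _).symm.trans ?_
    exact congrArg (GradedMonoid.mk _) (cupWith_assoc _ _ _ _ (fun u w z => mul_assoc u w z) _ _ _)
  natCast n := AlternatingMap.constOfIsEmpty A L (Fin 0) n
  natCast_zero := AlternatingMap.ext fun _ => Nat.cast_zero
  natCast_succ n := AlternatingMap.ext fun _ => Nat.cast_succ n
  intCast n := AlternatingMap.constOfIsEmpty A L (Fin 0) n
  intCast_ofNat n := AlternatingMap.ext fun _ => Int.cast_natCast n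
  intCast_negSucc_ofNat n := AlternatingMap.ext fun _ => Int.cast_negSucc n

end FormAlgebra

section FormAlgebra

open DirectSum

variable {k A L E F W : Type*} [Field k] [CharZero k] [CommRing A] [Algebra k A] [Algebra ℚ A]
  [LieRing L] [LieAlgebra k L] [Module A L] [LieRingModule L A] [LieRinehartRing A L]
  [LieRinehartAlgebra k A L]
  [Ring E] [Algebra A E] [Module k E] [IsScalarTower k A E]
  [Ring F] [Algebra A F] [Module k F] [IsScalarTower k A F]
  [AddCommGroup W] [Module k W] [Module A W] [IsScalarTower k A W]

lemma formOf_mul_formOf {p q : ℕ} (ω : L [⋀^Fin p]→ₗ[A] E) (η : L [⋀^Fin q]→ₗ[A] E) :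
    formOf k p ω * formOf k q η = formOf k (p + q) (cupWith (LinearMap.mul A E) ω η) :=
  DirectSum.of_mul_of (A := NForm A L E) ω η

lemma one_eq_formOf :
    (1 : Forms A L E) = formOf k 0 (AlternatingMap.constOfIsEmpty A L (Fin 0) 1) := rfl

lemma formOf_finCongr {n n' : ℕ} (e : n = n') (ω : L [⋀^Fin n]→ₗ[A] W) :
    formOf k n' (ω.domDomCongr (finCongr e)) = formOf k n ω := by
  subst e
  rfl

variable (k A L W) in
/-- Induction on forms: it suffices to treat homogeneous forms and sums. -/
lemma forms_induction {P : Forms A L W → Prop}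
    (hof : ∀ (n : ℕ) (ω : L [⋀^Fin n]→ₗ[A] W), P (formOf k n ω))
    (hadd : ∀ x y, P x → P y → P (x + y)) (x : Forms A L W) : P x := by
  induction x using DirectSum.induction_on with
  | zero => simpa only [map_zero] using hof 0 0
  | of n ω => exact hof n ω
  | add x y hx hy => exact hadd x y hx hy

instance (n : ℕ) : IsScalarTower k A (L [⋀^Fin n]→ₗ[A] W) := ⟨fun c a ω => by ext; simp⟩

lemma forms_smul_mul (c : k) (x y : Forms A L E) : c • x * y = c • (x * y) := by
  induction x using forms_induction k A L E with
  | hadd x x' hx hx' => rw [smul_add, add_mul, hx, hx', add_mul, smul_add]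
  | hof p ω =>
    induction y using forms_induction k A L E with
    | hadd x x' hx hx' => rw [mul_add, hx, hx', mul_add, smul_add]
    | hof q η =>
      rw [← map_smul, formOf_mul_formOf, formOf_mul_formOf, ← map_smul,
        ← algebraMap_smul A c ω, cupWith_smul_left, algebraMap_smul]

lemma forms_mul_smul (c : k) (x y : Forms A L E) : x * c • y = c • (x * y) := by
  induction x using forms_induction k A L E with
  | hadd x x' hx hx' => rw [add_mul, hx, hx', add_mul, smul_add]
  | hof p ω =>
    induction y using forms_induction k A L E with
    | hadd x x' hx hx' => rw [smul_add, mul_add, hx, hx', mul_add, smul_add]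
    | hof q η =>
      rw [← map_smul, formOf_mul_formOf, formOf_mul_formOf, ← map_smul,
        ← algebraMap_smul A c η, cupWith_smul_right, algebraMap_smul]

/-- The algebra of forms, over the ground field. -/
instance : Algebra k (Forms A L E) := Algebra.ofModule forms_smul_mul forms_mul_smul

lemma mapForms_mul (f : E →ₗ[A] F) (hf : ∀ x y, f (x * y) = f x * f y) (x y : Forms A L E) :
    mapForms k f (x * y) = mapForms k f x * mapForms k f y := by
  induction x using forms_induction k A L E with
  | hadd x x' hx hx' => rw [add_mul, map_add, map_add, hx, hx', add_mul]
  | hof p ω =>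
    induction y using forms_induction k A L E with
    | hadd x x' hx hx' => rw [mul_add, map_add, map_add, hx, hx', mul_add]
    | hof q η =>
      rw [formOf_mul_formOf, mapForms_formOf, mapForms_formOf, mapForms_formOf, formOf_mul_formOf,
        compAlternatingMap_cupWith _ (LinearMap.mul A F) f f f hf]

/-- The ring homomorphism on forms induced by a homomorphism of `A`-algebras. -/
noncomputable def mapFormsAlgHom (f : E →ₐ[A] F) : Forms A L E →ₐ[k] Forms A L F :=
  AlgHom.ofLinearMap (mapForms k f.toLinearMap)
    (by
      rw [one_eq_formOf (k := k), mapForms_formOf, one_eq_formOf (k := k)]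
      congr 1
      ext v
      simp)
    (mapForms_mul f.toLinearMap (by simp))

variable (k) in
/-- Multiplication by `(-1)ⁿ` on the `n`-forms with values in an algebra, as an algebra
endomorphism. -/
noncomputable def parityAlgHom : Forms A L E →ₐ[k] Forms A L E :=
  AlgHom.ofLinearMap (formLift k fun n => ((-1 : ℤ) ^ n) • formOf k n)
    (by
      rw [one_eq_formOf (k := k), formLift_formOf, pow_zero, one_smul])
    (fun x y => by
      induction x using forms_induction k A L E with
      | hadd x x' hx hx' => rw [add_mul, map_add, map_add, hx, hx', add_mul]
      | hof p ω =>
        induction y using forms_induction k A L E with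
        | hadd x x' hx hx' => rw [mul_add, map_add, map_add, hx, hx', mul_add]
        | hof q η =>
          simp only [formOf_mul_formOf, formLift_formOf, LinearMap.smul_apply, smul_mul_assoc,
            mul_smul_comm, smul_smul, pow_add, mul_comm])

lemma parityAlgHom_formOf (n : ℕ) (ω : L [⋀^Fin n]→ₗ[A] E) :
    parityAlgHom k (formOf k n ω) = (-1 : ℤ) ^ n • formOf k n ω := by
  simp [parityAlgHom]

/-- If `f` is symmetric, `f(x y) = f(y x)`, then on forms it is symmetric in the graded sense. -/
lemma mapForms_mul_comm_of_degree (f : E →ₗ[A] W) (hf : ∀ x y, f (x * y) = f (y * x))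
    {p : ℕ} (ω : L [⋀^Fin p]→ₗ[A] E) (y : Forms A L E) :
    mapForms k f (formOf k p ω * y) = mapForms k f ((parityAlgHom k ^ p) y * formOf k p ω) := by
  induction y using forms_induction k A L E with
  | hadd x x' hx hx' => simp only [mul_add, map_add, hx, hx', add_mul]
  | hof q η =>
    have h1 : ∀ m, (parityAlgHom k ^ m) (formOf k q η) = (-1 : ℤ) ^ (m * q) • formOf k q η := by
      intro m
      induction m with
      | zero => simp
      | succ m ih =>
        rw [pow_succ', AlgHom.mul_apply, ih, map_zsmul, parityAlgHom_formOf, smul_smul, ← pow_add]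
        congr 2
        ring
    have h3 : f.compAlternatingMap (cupWith (LinearMap.mul A E) η ω)
        = f.compAlternatingMap (cupWith (LinearMap.mul A E).flip η ω) := by
      ext v
      apply nsmul_cancel_of_algebra_rat A (mul_ne_zero q.factorial_ne_zero p.factorial_ne_zero)
      simp only [LinearMap.compAlternatingMap_apply, ← map_nsmul, factorial_smul_cupWith, map_sum,
        Units.smul_def, map_zsmul, LinearMap.mul_apply', LinearMap.flip_apply, hf]
    rw [h1, smul_mul_assoc, map_zsmul, formOf_mul_formOf, formOf_mul_formOf, mapForms_formOf,
      mapForms_formOf, h3, ← formOf_finCongr (Nat.add_comm q p), ← map_zsmul]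
    congr 1
    have h := cupWith_flip (LinearMap.mul A E) ω η
    ext v
    have h' := congrArg (fun g => (-1 : ℤ) ^ (p * q) • f (g v)) h
    simp only [AlternatingMap.smul_apply, map_zsmul, smul_smul, ← mul_pow] at h'
    simpa using h'.symm

end FormAlgebra

section Leibniz

variable {k A L E V : Type*} [Field k] [CharZero k] [CommRing A] [Algebra k A] [Algebra ℚ A]
  [LieRing L] [LieAlgebra k L] [Module A L] [LieRingModule L A] [LieRinehartRing A L]
  [LieRinehartAlgebra k A L]
  [Ring E] [Algebra A E] [Module k E] [IsScalarTower k A E]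

/-- The Leibniz rule: if a connection acts by derivations on the algebra of values, its covariant
derivative is an odd derivation of the algebra of forms. -/
theorem totalCovDeriv_mul (D : Connection k A L E)
    (hD : ∀ X x y, D.toLin X (x * y) = D.toLin X x * y + x * D.toLin X y) (x y : Forms A L E) :
    totalCovDeriv D (x * y) = totalCovDeriv D x * y + parityAlgHom k x * totalCovDeriv D y := by
  induction x using forms_induction k A L E with
  | hadd x x' hx hx' => simp only [add_mul, map_add, hx, hx']; abel
  | hof p ω =>
    induction y using forms_induction k A L E with
    | hadd x x' hx hx' => simp only [mul_add, map_add, hx, hx']; abel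
    | hof q η =>
      simp only [formOf_mul_formOf, totalCovDeriv_formOf, parityAlgHom_formOf, smul_mul_assoc]
      rw [covDeriv_cupWith D D D (LinearMap.mul A E) hD, map_add, formOf_finCongr, map_zsmul]
      rfl

end Leibniz

/-! ### Transgression in differential graded algebras with curvature -/

section Transgression

open Polynomial

variable {k Ω M : Type*} [Field k] [CharZero k] [Ring Ω] [Algebra k Ω] [AddCommGroup M]
  [Module k M]

/-- The integral `p ↦ ∫₀¹ p(t) dt` of polynomials. -/
noncomputable def unitIntegral (k : Type*) [Field k] : k[X] →ₗ[k] k :=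
  Polynomial.lsum fun n => ((n : k) + 1)⁻¹ • LinearMap.id

lemma unitIntegral_monomial (n : ℕ) (c : k) :
    unitIntegral k (monomial n c) = ((n : k) + 1)⁻¹ * c := by
  simp [unitIntegral, Polynomial.lsum_apply]

/-- The fundamental theorem of calculus for polynomials. -/
lemma unitIntegral_derivative (p : k[X]) :
    unitIntegral k (derivative p) = p.eval 1 - p.eval 0 := by
  induction p using Polynomial.induction_on' with
  | add p q hp hq => simp only [map_add, hp, hq, eval_add]; ring
  | monomial n c =>
    rw [derivative_monomial, unitIntegral_monomial]
    cases n with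
    | zero => simp
    | succ n =>
      have : (n : k) + 1 ≠ 0 := Nat.cast_add_one_ne_zero n
      simp
      field_simp

/-- Differentiation in the parameter `t` on `Ω[t] = Ω ⊗ k[t]` is a derivation. -/
lemma lTensor_derivative_mul (x y : Ω ⊗[k] k[X]) :
    (derivative (R := k)).lTensor Ω (x * y)
      = (derivative (R := k)).lTensor Ω x * y + x * (derivative (R := k)).lTensor Ω y := by
  induction x using TensorProduct.induction_on with
  | zero => simp
  | add x x' hx hx' => simp only [add_mul, map_add, hx, hx']; abel
  | tmul a p =>
    induction y using TensorProduct.induction_on with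
    | zero => simp
    | add x x' hx hx' => simp only [mul_add, map_add, hx, hx']; abel
    | tmul b q =>
      simp only [Algebra.TensorProduct.tmul_mul_tmul, LinearMap.lTensor_tmul, derivative_mul,
        TensorProduct.tmul_add]

/-- An odd derivation of `Ω`, extended `t`-linearly, is an odd derivation of `Ω[t]`. -/
lemma rTensor_mul (ε : Ω →ₐ[k] Ω) (d : Ω →ₗ[k] Ω)
    (hd : ∀ x y, d (x * y) = d x * y + ε x * d y) (x y : Ω ⊗[k] k[X]) :
    d.rTensor k[X] (x * y) = d.rTensor k[X] x * y
      + Algebra.TensorProduct.map ε (AlgHom.id k k[X]) x * d.rTensor k[X] y := by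
  induction x using TensorProduct.induction_on with
  | zero => simp
  | add x x' hx hx' => simp only [add_mul, map_add, hx, hx']; abel
  | tmul a p =>
    induction y using TensorProduct.induction_on with
    | zero => simp
    | add x x' hx hx' => simp only [mul_add, map_add, hx, hx']; abel
    | tmul b q =>
      simp only [Algebra.TensorProduct.tmul_mul_tmul, LinearMap.rTensor_tmul, hd,
        TensorProduct.add_tmul, Algebra.TensorProduct.map_tmul, AlgHom.id_apply]

/-- A functional that is cyclic for multiplication by `P` sends `(P^m)'` to `m P^(m-1) P'`. -/
lemma map_derivation_pow {Q N : Type*} [Ring Q] [AddCommGroup N] (δ : Q →+ Q)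
    (hδ : ∀ x y, δ (x * y) = δ x * y + x * δ y) (τ : Q →+ N) (P : Q)
    (hτ : ∀ z, τ (z * P) = τ (P * z)) (m j : ℕ) :
    τ (P ^ j * δ (P ^ m)) = m • τ (P ^ (j + m - 1) * δ P) := by
  induction m generalizing j with
  | zero =>
    have h1 : δ 1 = 0 := by simpa using hδ 1 1
    simp [h1]
  | succ m ih =>
    rw [pow_succ, hδ, mul_add, map_add, ← mul_assoc, hτ, ← mul_assoc, ← mul_assoc, ← pow_succ',
      ih (j + 1), ← pow_add, succ_nsmul]
    congr 3
    congr 2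
    omega

/-- **Transgression.** Let `d` be an odd derivation of an algebra `Ω` with parity automorphism `ε`,
let `τ` be a graded trace on `Ω` with `τ ∘ d = δ ∘ τ`, and let `R` satisfy the Bianchi identity
`d R = 0`, and `d² B = [R, B]` for an odd `B`. Passing from `d` to `d + [B, ·]` replaces `R` by
`R + dB + B²`, and this changes `τ(R^m)` by an element of the range of `δ`. -/
theorem transgression (ε : Ω →ₐ[k] Ω) (d : Ω →ₗ[k] Ω)
    (hd : ∀ x y, d (x * y) = d x * y + ε x * d y) (τ : Ω →ₗ[k] M) (δ : M →ₗ[k] M)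
    (hτd : ∀ x, τ (d x) = δ (τ x)) (R B : Ω) (hεR : ε R = R) (hεB : ε B = -B)
    (hεdB : ε (d B) = d B) (hR : d R = 0) (hddB : d (d B) = R * B - B * R)
    (hτR : ∀ x, τ (R * x) = τ (x * R)) (hτdB : ∀ x, τ (d B * x) = τ (x * d B))
    (hτB : ∀ x, τ (B * x) = τ (ε x * B)) (hτB2 : ∀ x, τ (B * B * x) = τ (x * (B * B))) (m : ℕ) :
    τ ((R + d B + B * B) ^ m) - τ (R ^ m) ∈ LinearMap.range δ := by
  -- The family `P = R + t dB + t² B²` of curvatures, with the derivation `D = d + t [B, ·]`.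
  let P : Ω ⊗[k] k[X] := R ⊗ₜ 1 + d B ⊗ₜ X + (B * B) ⊗ₜ (X ^ 2)
  let b : Ω ⊗[k] k[X] := B ⊗ₜ 1
  let bt : Ω ⊗[k] k[X] := B ⊗ₜ X
  let e := Algebra.TensorProduct.map ε (AlgHom.id k k[X])
  let D : Ω ⊗[k] k[X] →ₗ[k] Ω ⊗[k] k[X] :=
    d.rTensor k[X] + LinearMap.mulLeft k bt - LinearMap.mulRight k bt ∘ₗ e.toLinearMap
  have hDapp : ∀ x, D x = d.rTensor k[X] x + bt * x - e x * bt := fun x => rfl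
  -- differentiation in `t`
  let Dt := (derivative (R := k)).lTensor Ω
  -- the functional `Λ = ∫₀¹ τ dt`
  let Λ : Ω ⊗[k] k[X] →ₗ[k] M :=
    (TensorProduct.rid k M).toLinearMap ∘ₗ TensorProduct.map τ (unitIntegral k)
  have hΛ : ∀ x p, Λ (x ⊗ₜ p) = unitIntegral k p • τ x := fun x p => by simp [Λ]
  have hD : ∀ x y, D (x * y) = D x * y + e x * D y := fun x y => by
    rw [hDapp, hDapp, hDapp, rTensor_mul ε d hd, map_mul,
      show Algebra.TensorProduct.map ε (AlgHom.id k k[X]) = e from rfl]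
    simp only [add_mul, sub_mul, mul_add, mul_sub, mul_assoc]
    abel
  have heP : e P = P := by
    simp [e, P, hεR, hεdB, hεB]
  have hDP : D P = 0 := by
    have hX2 : (X : k[X]) * X = X ^ 2 := (pow_two X).symm
    have hX3 : (X : k[X]) * X ^ 2 = X ^ 2 * X := (pow_mul_comm' X 2).symm
    have hdBB : d (B * B) = d B * B - B * d B := by rw [hd, hεB, neg_mul, sub_eq_add_neg]
    rw [hDapp, heP]
    simp only [P, bt, map_add, LinearMap.rTensor_tmul, hR, hddB, hdBB, mul_add, add_mul,
      Algebra.TensorProduct.tmul_mul_tmul, TensorProduct.sub_tmul, one_mul,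
      mul_one, TensorProduct.zero_tmul, ← mul_assoc, hX2, hX3]
    abel
  have hDPm : ∀ m : ℕ, D (P ^ m) = 0 := fun m => by
    induction m with
    | zero => simp [hDapp]; simp [Algebra.TensorProduct.one_def, show d 1 = 0 by simpa using hd 1 1]
    | succ m ih => rw [pow_succ, hD, ih, hDP, zero_mul, mul_zero, add_zero]
  have hP' : Dt P = D b := by
    rw [hDapp]
    simp only [Dt, P, b, bt, e, map_add, LinearMap.lTensor_tmul, LinearMap.rTensor_tmul,
      Algebra.TensorProduct.map_tmul, AlgHom.id_apply, derivative_one, derivative_X, hεB,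
      Algebra.TensorProduct.tmul_mul_tmul, TensorProduct.tmul_zero, one_mul, mul_one, zero_add,
      neg_mul, TensorProduct.neg_tmul, sub_neg_eq_add, derivative_X_pow]
    rw [add_assoc, ← TensorProduct.tmul_add]
    congr 2
    simp only [Nat.cast_ofNat, map_ofNat]
    ring
  have hΛP : ∀ z, Λ (z * P) = Λ (P * z) := fun z => by
    induction z using TensorProduct.induction_on with
    | zero => simp
    | add x x' hx hx' => simp only [add_mul, mul_add, map_add] at hx hx' ⊢; simp only [hx, hx']
    | tmul a p =>
      simp only [P, mul_add, add_mul, map_add, Algebra.TensorProduct.tmul_mul_tmul, hΛ, hτR, hτdB,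
        hτB2, mul_comm p]
  -- The graded commutator `t [B, ·]` in `D` is killed by the trace.
  have hΛD : ∀ z, Λ (D z) ∈ LinearMap.range δ := fun z => by
    induction z using TensorProduct.induction_on with
    | zero => simp
    | add x x' hx hx' => simp only [map_add]; exact add_mem hx hx'
    | tmul a p =>
      refine ⟨unitIntegral k p • τ a, ?_⟩
      simp only [hDapp, map_add, map_sub, LinearMap.rTensor_tmul, bt, e,
        Algebra.TensorProduct.map_tmul, AlgHom.id_apply, Algebra.TensorProduct.tmul_mul_tmul, hΛ,
        hτd, hτB, mul_comm X p, map_smul, add_sub_cancel_right]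
  -- the fundamental theorem of calculus in `Ω[t]`, with values at `t = 1` and `t = 0`
  have hΛd : ∀ z, Λ (Dt z) = (TensorProduct.rid k M).toLinearMap
      (TensorProduct.map τ (Polynomial.leval 1) z)
      - (TensorProduct.rid k M).toLinearMap (TensorProduct.map τ (Polynomial.leval 0) z) :=
    fun z => by
    induction z using TensorProduct.induction_on with
    | zero => simp
    | add x x' hx hx' => simp only [map_add, hx, hx']; abel
    | tmul a p =>
      simp [Dt, hΛ, unitIntegral_derivative, sub_smul]
  have hev : ∀ c : k, ∀ z : Ω ⊗[k] k[X], (TensorProduct.rid k M).toLinearMap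
      (TensorProduct.map τ (Polynomial.leval c) z) = τ ((Algebra.TensorProduct.rid k k Ω)
        (Algebra.TensorProduct.map (AlgHom.id k Ω) (Polynomial.aeval c) z)) := fun c z => by
    induction z using TensorProduct.induction_on with
    | zero => simp
    | add x x' hx hx' => simp only [map_add, hx, hx']
    | tmul a p => simp [Polynomial.aeval_def, Polynomial.eval₂_eq_eval_map]
  have h := map_derivation_pow Dt.toAddMonoidHom lTensor_derivative_mul Λ.toAddMonoidHom P hΛP m 0
  simp only [LinearMap.toAddMonoidHom_coe, pow_zero, one_mul, zero_add] at h
  rw [hΛd, hev, hev, hP'] at h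
  -- `∂(P^m)` has the same image under `Λ` as `m P^(m-1) D b = m D(P^(m-1) b)`.
  have hb : P ^ (m - 1) * D b = D (P ^ (m - 1) * b) := by
    rw [hD, hDPm, zero_mul, zero_add, map_pow, heP]
  simp only [map_pow] at h
  have e1 : τ ((R + d B + B * B) ^ m) - τ (R ^ m) = m • Λ (P ^ (m - 1) * D b) := by
    rw [← h]
    simp [P]
  rw [e1, hb]
  exact nsmul_mem (hΛD _) m

end Transgression

/-! ### Independence of the connection -/

section Independence

variable {k A L V : Type*} [Field k] [CharZero k] [CommRing A] [Algebra k A] [Algebra ℚ A]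
  [LieRing L] [LieAlgebra k L] [Module A L] [LieRingModule L A] [LieRinehartRing A L]
  [LieRinehartAlgebra k A L]
  [AddCommGroup V] [Module k V] [Module A V] [IsScalarTower k A V]

/-- The difference `X ↦ ∇'_X - ∇_X` of two connections, an `End_A(V)`-valued one-form. -/
def connectionDiff (D D' : Connection k A L V) : L [⋀^Fin 1]→ₗ[A] Module.End A V :=
  AlternatingMap.ofSubsingleton A L (Module.End A V) (0 : Fin 1)
    { toFun := fun X =>
        { toFun := fun v => D'.toLin X v - D.toLin X v
          map_add' := fun v w => by simp only [map_add]; abel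
          map_smul' := fun a v => by
            simp only [D.leibniz, D'.leibniz, RingHom.id_apply, smul_sub]; abel }
      map_add' := fun X Y => by ext v; simp; abel
      map_smul' := fun a X => by ext v; simp [smul_sub] }

lemma connectionDiff_apply (D D' : Connection k A L V) (x : Fin 1 → L) (v : V) :
    connectionDiff D D' x v = D'.toLin (x 0) v - D.toLin (x 0) v := rfl

lemma onEnd_apply (D : Connection k A L V) (X : L) (φ : Module.End A V) (v : V) :
    D.onEnd.toLin X φ v = D.toLin X (φ v) - φ (D.toLin X v) := rfl

/-- The curvature of a second connection, `R' = R + dB + B ∪ B`. -/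
lemma curvature_eq_add (D D' : Connection k A L V) :
    curvature D' = curvature D + covDeriv D.onEnd (connectionDiff D D')
      + cupWith (LinearMap.mul A (Module.End A V)) (connectionDiff D D')
        (connectionDiff D D') := by
  ext v w
  have h : covDeriv D.onEnd (connectionDiff D D') v w
    = koszul D.onEnd (connectionDiff D D') v w := rfl
  have h2 := cupWith_one_apply (LinearMap.mul A (Module.End A V)) (connectionDiff D D')
    (connectionDiff D D') v
  have h3 : v ∘ finCongr (Nat.add_comm 1 1) = v := rfl
  rw [h3] at h2
  have ht : Fin.tail v 0 = v 1 := rfl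
  have i0 : (Finset.Ici (0 : Fin 1)) = {0} := by decide
  simp only [AlternatingMap.add_apply, LinearMap.add_apply, h, h2]
  simp [-lie_lie, -lie_skew, koszul, koszulBracket, curvature, curvatureEnd, onEnd_apply,
    connectionDiff_apply, Fin.sum_univ_succ, Fin.removeNth, i0, ht, Fin.succAbove]
  abel

/-- The covariant derivative of a second connection is `d' = d + [B, ·]`, in the graded sense. -/
lemma totalCovDeriv_onEnd_eq (D D' : Connection k A L V) (x : Forms A L (Module.End A V)) :
    totalCovDeriv D'.onEnd x = totalCovDeriv D.onEnd x
      + formOf k 1 (connectionDiff D D') * x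
      - parityAlgHom k x * formOf k 1 (connectionDiff D D') := by
  induction x using forms_induction k A L (Module.End A V) with
  | hadd x x' hx hx' => simp only [map_add, mul_add, add_mul, hx, hx']; abel
  | hof n ω =>
    let B := connectionDiff D D'
    have h1 := fun v => cupWith_one_apply (LinearMap.mul A (Module.End A V)) B ω v
    have h2 := fun v => cupWith_one_apply (LinearMap.mul A (Module.End A V)).flip B ω v
    have h3 := cupWith_flip (LinearMap.mul A (Module.End A V)) ω B
    rw [mul_one] at h3
    -- `cupWith_flip` turns `ω ∪ B` into a product with the one-form on the left, so that all terms
    -- are alternating sums over the omitted argument.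
    have key : covDeriv D'.onEnd ω = covDeriv D.onEnd ω
        + (cupWith (LinearMap.mul A (Module.End A V)) B ω).domDomCongr
            (finCongr (Nat.add_comm 1 n))
        - (-1 : ℤ) ^ n • cupWith (LinearMap.mul A (Module.End A V)) ω B := by
      rw [← h3]
      ext v w
      simp only [covDeriv_apply, AlternatingMap.sub_apply, AlternatingMap.add_apply,
        AlternatingMap.domDomCongr_apply, h1, h2, lam, LinearMap.sum_apply, LinearMap.sub_apply,
        LinearMap.add_apply, LinearMap.smul_apply, ← Finset.sum_add_distrib,
        ← Finset.sum_sub_distrib]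
      refine Finset.sum_congr rfl fun i _ => ?_
      rw [← smul_add, ← smul_sub]
      congr 1
      simp only [onEnd_apply, B, connectionDiff_apply, LinearMap.mul_apply', LinearMap.flip_apply,
        Module.End.mul_apply, map_sub]
      abel
    rw [totalCovDeriv_formOf, totalCovDeriv_formOf, key, map_sub, map_add, formOf_finCongr,
      map_zsmul, parityAlgHom_formOf, smul_mul_assoc, formOf_mul_formOf, formOf_mul_formOf]

variable (k) in
/-- The curvature, as an element of the algebra of forms. -/
noncomputable def curvatureForm (D : Connection k A L V) : Forms A L (Module.End A V) :=
  formOf k 2 (curvature D)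

lemma formOf_curvaturePow (D : Connection k A L V) (m : ℕ) :
    formOf k (2 * m) (curvaturePow D m) = curvatureForm k D ^ m := by
  induction m with
  | zero => rw [pow_zero]; exact (one_eq_formOf (k := k)).symm
  | succ m ih =>
    rw [pow_succ, ← ih, curvatureForm, formOf_mul_formOf]
    rfl

lemma curvatureForm_eq_add (D D' : Connection k A L V) :
    curvatureForm k D' = curvatureForm k D
      + totalCovDeriv D.onEnd (formOf k 1 (connectionDiff D D'))
      + formOf k 1 (connectionDiff D D') * formOf k 1 (connectionDiff D D') := by
  rw [curvatureForm, curvature_eq_add D D', map_add, map_add, totalCovDeriv_formOf,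
    formOf_mul_formOf, curvatureForm]

/-- The second Bianchi identity in the algebra of forms. -/
lemma totalCovDeriv_curvatureForm (D : Connection k A L V) :
    totalCovDeriv D.onEnd (curvatureForm k D) = 0 := by
  rw [curvatureForm, totalCovDeriv_formOf, bianchi, map_zero]

lemma totalCovDeriv_onEnd_mul (D : Connection k A L V) (x y : Forms A L (Module.End A V)) :
    totalCovDeriv D.onEnd (x * y)
      = totalCovDeriv D.onEnd x * y + parityAlgHom k x * totalCovDeriv D.onEnd y :=
  totalCovDeriv_mul D.onEnd (onEnd_mul D) x y

/-- `d² B = [R, B]`: a consequence of the Bianchi identities for both connections. -/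
lemma totalCovDeriv_totalCovDeriv_connectionDiff (D D' : Connection k A L V) :
    totalCovDeriv D.onEnd (totalCovDeriv D.onEnd (formOf k 1 (connectionDiff D D')))
      = curvatureForm k D * formOf k 1 (connectionDiff D D')
        - formOf k 1 (connectionDiff D D') * curvatureForm k D := by
  have h := totalCovDeriv_curvatureForm D'
  have hR := totalCovDeriv_curvatureForm D
  have e1 : parityAlgHom k (formOf k 1 (connectionDiff D D'))
      = - formOf k 1 (connectionDiff D D') := by rw [parityAlgHom_formOf]; simp
  have e2 : parityAlgHom k (curvatureForm k D) = curvatureForm k D := by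
    rw [curvatureForm, parityAlgHom_formOf]; simp
  have e3 : parityAlgHom k (totalCovDeriv D.onEnd (formOf k 1 (connectionDiff D D')))
      = totalCovDeriv D.onEnd (formOf k 1 (connectionDiff D D')) := by
    rw [totalCovDeriv_formOf, parityAlgHom_formOf]; simp
  rw [totalCovDeriv_onEnd_eq D D', curvatureForm_eq_add D D'] at h
  simp only [map_add, map_mul, hR, totalCovDeriv_onEnd_mul, e1, e2, e3] at h
  rw [← sub_eq_zero, ← h]
  simp only [mul_add, add_mul, neg_mul, mul_neg, mul_assoc]
  abel

variable [Module.Finite A V] [Module.Projective A V]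

/-- The trace is symmetric. -/
lemma projTrace_mul_comm (φ ψ : Module.End A V) :
    projTrace A V (φ * ψ) = projTrace A V (ψ * φ) := by
  obtain ⟨t, rfl⟩ := (dualTensorHomEquiv A V V).surjective φ
  induction t using TensorProduct.induction_on with
  | zero => simp
  | add x y hx hy => simp only [map_add, add_mul, mul_add, hx, hy]
  | tmul f v =>
    have e : dualTensorHomEquiv A V V (f ⊗ₜ v) = dualTensorHom A V V (f ⊗ₜ v) := rfl
    have h1 : dualTensorHom A V V (f ⊗ₜ v) * ψ = dualTensorHom A V V ((f ∘ₗ ψ) ⊗ₜ v) := by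
      ext w; simp
    have h2 : ψ * dualTensorHom A V V (f ⊗ₜ v) = dualTensorHom A V V (f ⊗ₜ ψ v) := by
      ext w; simp
    rw [e, h1, h2, projTrace_dualTensorHom, projTrace_dualTensorHom, LinearMap.comp_apply]

/-- Two-forms are even, so they can be moved cyclically under the trace. -/
lemma mapForms_projTrace_mul_comm (ω : L [⋀^Fin 2]→ₗ[A] Module.End A V)
    (y : Forms A L (Module.End A V)) :
    mapForms k (projTrace A V) (formOf k 2 ω * y)
      = mapForms k (projTrace A V) (y * formOf k 2 ω) := by
  have hs : (parityAlgHom k ^ 2) y = y := by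
    rw [pow_two, AlgHom.mul_apply]
    induction y using forms_induction k A L (Module.End A V) with
    | hadd x x' hx hx' => rw [map_add, map_add, hx, hx']
    | hof n ω =>
      rw [parityAlgHom_formOf, map_zsmul, parityAlgHom_formOf, smul_smul, ← mul_pow, neg_one_mul,
        neg_neg, one_pow, one_smul]
  rw [mapForms_mul_comm_of_degree (projTrace A V) projTrace_mul_comm ω y, hs]

/-- One-forms are odd: moving them cyclically under the trace costs a sign. -/
lemma mapForms_projTrace_mul_comm_one (ω : L [⋀^Fin 1]→ₗ[A] Module.End A V)
    (y : Forms A L (Module.End A V)) :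
    mapForms k (projTrace A V) (formOf k 1 ω * y)
      = mapForms k (projTrace A V) (parityAlgHom k y * formOf k 1 ω) := by
  rw [mapForms_mul_comm_of_degree (projTrace A V) projTrace_mul_comm ω y, pow_one]

/-- The trace intertwines the covariant derivative with the de Rham differential. -/
lemma dDR_mapForms_projTrace (D : Connection k A L V) (x : Forms A L (Module.End A V)) :
    mapForms k (projTrace A V) (totalCovDeriv D.onEnd x)
      = dDR k A L (mapForms k (projTrace A V) x) :=
  (totalCovDeriv_mapForms D.onEnd (trivialConnection k A L) _
    (fun X φ => (projTrace_onEnd D X φ).symm) x).symm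

/-- The trace forms `tr(R^m)` of two connections differ by an exact form. -/
theorem trace_curvaturePow_sub_mem_range (D D' : Connection k A L V) (m : ℕ) :
    mapForms k (projTrace A V) (curvatureForm k D' ^ m)
      - mapForms k (projTrace A V) (curvatureForm k D ^ m) ∈ LinearMap.range (dDR k A L) := by
  have e1 : parityAlgHom k (formOf k 1 (connectionDiff D D'))
      = - formOf k 1 (connectionDiff D D') := by
    rw [parityAlgHom_formOf, pow_one, neg_smul, one_smul]
  have e2 : ∀ ω : L [⋀^Fin 2]→ₗ[A] Module.End A V,
      parityAlgHom k (formOf k 2 ω) = formOf k 2 ω := fun ω => by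
    rw [parityAlgHom_formOf, neg_one_sq, one_smul]
  have e3 := totalCovDeriv_formOf D.onEnd 1 (connectionDiff D D')
  have e4 := formOf_mul_formOf (k := k) (connectionDiff D D') (connectionDiff D D')
  rw [curvatureForm_eq_add D D']
  have h := transgression (Ω := Forms A L (Module.End A V)) (M := Forms A L A) (parityAlgHom k)
    (totalCovDeriv D.onEnd) (totalCovDeriv_onEnd_mul D) (mapForms k (projTrace A V)) (dDR k A L)
    (dDR_mapForms_projTrace D) (curvatureForm k D) (formOf k 1 (connectionDiff D D'))
    (e2 (curvature D)) e1
  refine h ?_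
    (totalCovDeriv_curvatureForm D) (totalCovDeriv_totalCovDeriv_connectionDiff D D')
    (mapForms_projTrace_mul_comm _) ?_ (mapForms_projTrace_mul_comm_one _) ?_ m
  · rw [e3]
    exact e2 _
  · rw [e3]
    exact mapForms_projTrace_mul_comm _
  · rw [e4]
    exact mapForms_projTrace_mul_comm _

/-- Since `L` is finitely generated, the curvature is nilpotent, uniformly in the connection. -/
lemma exists_curvatureForm_pow_eq_zero [Module.Finite A L] :
    ∃ N : ℕ, ∀ (D : Connection k A L V) (n : ℕ), N ≤ n → curvatureForm k D ^ n = 0 := by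
  obtain ⟨N, hN⟩ := exists_forms_eq_zero A L (Module.End A V)
  refine ⟨N + 1, fun D n hn => ?_⟩
  rw [← formOf_curvaturePow, hN (2 * n) (by omega) (curvaturePow D n), map_zero]

lemma expCurvature_eq_sum (κ : k) (D : Connection k A L V) {n : ℕ}
    (hn : ∀ m, n ≤ m → curvatureForm k D ^ m = 0) :
    expCurvature κ D
      = ∑ m ∈ Finset.range n, (κ ^ m / (m.factorial : k)) • curvatureForm k D ^ m := by
  rw [expCurvature, finsum_eq_sum_of_support_subset]
  · exact Finset.sum_congr rfl fun m _ => by rw [formOf_curvaturePow]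
  · intro m hm
    by_contra h
    simp only [Finset.coe_range, Set.mem_Iio, not_lt] at h
    exact hm (by simp only [formOf_curvaturePow, hn m h, smul_zero])

/-- The class of the Chern form does not depend on the connection. -/
theorem chernClass_eq [Module.Finite A L] (κ : k) (D D' : Connection k A L V) :
    chernClass κ D = chernClass κ D' := by
  refine (Submodule.Quotient.eq _).mpr ?_
  change chernForm κ D - chernForm κ D' ∈ LinearMap.range (dDR k A L)
  obtain ⟨N, hN⟩ := exists_curvatureForm_pow_eq_zero (k := k) (A := A) (L := L) (V := V)
  rw [chernForm, chernForm, expCurvature_eq_sum κ D (hN D), expCurvature_eq_sum κ D' (hN D'),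
    map_sum, map_sum, ← Finset.sum_sub_distrib]
  refine Submodule.sum_mem _ fun m _ => ?_
  rw [map_smul, map_smul, ← smul_sub]
  exact Submodule.smul_mem _ _ (trace_curvaturePow_sub_mem_range D' D m)

end Independence

/-! ### Products of forms with different values, and the exponential -/
section Products

variable {k A L E E' F W : Type*} [Field k] [CharZero k] [CommRing A] [Algebra k A] [Algebra ℚ A]
  [LieRing L] [LieAlgebra k L] [Module A L] [LieRingModule L A] [LieRinehartRing A L]
  [LieRinehartAlgebra k A L]
  [Ring E] [Algebra A E] [Module k E] [IsScalarTower k A E]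
  [Ring E'] [Algebra A E'] [Module k E'] [IsScalarTower k A E']
  [Ring F] [Algebra A F] [Module k F] [IsScalarTower k A F]
  [AddCommGroup W] [Module k W] [Module A W] [IsScalarTower k A W]

lemma mapForms_comp (f : E →ₗ[A] F) (g : F →ₗ[A] W) (x : Forms A L E) :
    mapForms k g (mapForms k f x) = mapForms k (g ∘ₗ f) x := by
  induction x using forms_induction k A L E with
  | hadd x x' hx hx' => simp only [map_add, hx, hx']
  | hof n ω => simp only [mapForms_formOf]; rfl

/-- The product of forms with values in `E` and `E'`, after mapping the values to `F`, is the cup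
product along `(x, y) ↦ f x * g y`. -/
lemma mapForms_formOf_mul_mapForms_formOf (f : E →ₗ[A] F) (g : E' →ₗ[A] F) {p q : ℕ}
    (ω : L [⋀^Fin p]→ₗ[A] E) (η : L [⋀^Fin q]→ₗ[A] E') :
    mapForms k f (formOf k p ω) * mapForms k g (formOf k q η)
      = formOf k (p + q) (cupWith ((LinearMap.mul A F).compl₁₂ f g) ω η) := by
  rw [mapForms_formOf, mapForms_formOf, formOf_mul_formOf,
    ← compAlternatingMap_cupWith ((LinearMap.mul A F).compl₁₂ f g) (LinearMap.mul A F) f g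
      LinearMap.id (fun _ _ => rfl)]
  rfl

/-- Forms with values in mutually annihilating subspaces annihilate each other. -/
lemma mapForms_mul_mapForms_eq_zero (f : E →ₗ[A] F) (g : E' →ₗ[A] F)
    (h : ∀ x y, f x * g y = 0) (x : Forms A L E) (y : Forms A L E') :
    mapForms k f x * mapForms k g y = 0 := by
  induction x using forms_induction k A L E with
  | hadd x x' hx hx' => rw [map_add, add_mul, hx, hx', add_zero]
  | hof p ω =>
    induction y using forms_induction k A L E' with
    | hadd x x' hx hx' => rw [map_add, mul_add, hx, hx', add_zero]
    | hof q η =>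
      have h0 : (LinearMap.mul A F).compl₁₂ f g = 0 := LinearMap.ext₂ h
      have : cupWith (0 : E →ₗ[A] E' →ₗ[A] F) ω η = 0 := by
        ext v
        apply nsmul_cancel_of_algebra_rat A (mul_ne_zero p.factorial_ne_zero q.factorial_ne_zero)
        rw [factorial_smul_cupWith]
        simp
      rw [mapForms_formOf_mul_mapForms_formOf, h0, this, map_zero]

/-- Two-forms with values in commuting subspaces commute. -/
lemma commute_mapForms_of_commute (f : E →ₗ[A] F) (g : E' →ₗ[A] F)
    (h : ∀ x y, f x * g y = g y * f x) (ω : L [⋀^Fin 2]→ₗ[A] E) (η : L [⋀^Fin 2]→ₗ[A] E') :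
    Commute (mapForms k f (formOf k 2 ω)) (mapForms k g (formOf k 2 η)) := by
  have hf : (LinearMap.mul A F).compl₁₂ g f = ((LinearMap.mul A F).compl₁₂ f g).flip :=
    LinearMap.ext₂ fun y x => (h x y).symm
  -- The sign for two forms of degree two is `(-1)^4`.
  have h1 := cupWith_flip ((LinearMap.mul A F).compl₁₂ f g) ω η
  rw [Even.neg_one_pow (by decide), one_smul] at h1
  rw [Commute, SemiconjBy, mapForms_formOf_mul_mapForms_formOf,
    mapForms_formOf_mul_mapForms_formOf, hf, ← h1]
  rfl

/-- A map that is multiplicative on products `f x * g y` is multiplicative on products of forms. -/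
lemma mapForms_mapForms_mul_mapForms (f : E →ₗ[A] F) (g : E' →ₗ[A] F) (τ : F →ₗ[A] A)
    (τ₁ : E →ₗ[A] A) (τ₂ : E' →ₗ[A] A) (h : ∀ x y, τ (f x * g y) = τ₁ x * τ₂ y)
    (x : Forms A L E) (y : Forms A L E') :
    mapForms k τ (mapForms k f x * mapForms k g y)
      = cupForms k A L (mapForms k τ₁ x) (mapForms k τ₂ y) := by
  induction x using forms_induction k A L E with
  | hadd x x' hx hx' => simp only [map_add, add_mul, hx, hx', LinearMap.add_apply]
  | hof p ω =>
    induction y using forms_induction k A L E' with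
    | hadd x x' hx hx' => simp only [map_add, mul_add, hx, hx']
    | hof q η =>
      rw [mapForms_formOf_mul_mapForms_formOf, mapForms_formOf, mapForms_formOf, mapForms_formOf,
        cupForms_formOf, compAlternatingMap_cupWith _ (LinearMap.mul A A) τ₁ τ₂ τ h]

end Products

section Exponential

variable {k : Type*} [Field k] [CharZero k]

/-- Multiplicativity `exp(κ(x + y)) = exp(κ x) exp(κ y)` for commuting nilpotent elements, with the
exponentials written as truncated series. -/
lemma sum_pow_smul_add_of_commute {Ω : Type*} [Ring Ω] [Algebra k Ω] (κ : k) {x y : Ω}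
    (h : Commute x y) {n : ℕ} (hx : x ^ n = 0) (hy : y ^ n = 0) (hxy : (x + y) ^ n = 0) :
    ∑ m ∈ Finset.range n, (κ ^ m / (m.factorial : k)) • (x + y) ^ m
      = (∑ m ∈ Finset.range n, (κ ^ m / (m.factorial : k)) • x ^ m)
        * ∑ m ∈ Finset.range n, (κ ^ m / (m.factorial : k)) • y ^ m := by
  let _ : Module ℚ Ω := Module.compHom Ω (algebraMap ℚ k)
  have hs : ∀ (q : ℚ) (z : Ω), q • z = (q : k) • z := fun q z => rfl
  have key : ∀ z : Ω, z ^ n = 0 → ∑ m ∈ Finset.range n, (κ ^ m / (m.factorial : k)) • z ^ m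
      = IsNilpotent.exp (κ • z) := fun z hz => by
    rw [IsNilpotent.exp_eq_sum (k := n) (by rw [smul_pow, hz, smul_zero])]
    refine Finset.sum_congr rfl fun m _ => ?_
    rw [hs, smul_pow, smul_smul]
    push_cast
    rw [div_eq_inv_mul]
  rw [key _ hx, key _ hy, key _ hxy, smul_add, IsNilpotent.exp_add_of_commute
    ((h.smul_left κ).smul_right κ) ⟨n, by rw [smul_pow, hx, smul_zero]⟩
    ⟨n, by rw [smul_pow, hy, smul_zero]⟩]

end Exponential

/-! ### The direct sum of two connections -/

section DirectSum

variable {k A L V V' : Type*} [Field k] [CharZero k] [CommRing A] [Algebra k A]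
  [LieRing L] [LieAlgebra k L] [Module A L] [LieRingModule L A] [LieRinehartRing A L]
  [LieRinehartAlgebra k A L]
  [AddCommGroup V] [Module k V] [Module A V] [IsScalarTower k A V]
  [AddCommGroup V'] [Module k V'] [Module A V'] [IsScalarTower k A V']

/-- The direct sum of two connections. -/
def Connection.prod (D : Connection k A L V) (D' : Connection k A L V') :
    Connection k A L (V × V') where
  toLin :=
    { toFun := fun X => (D.toLin X).prodMap (D'.toLin X)
      map_add' := fun X Y => by ext <;> simp
      map_smul' := fun a X => by ext <;> simp }
  leibniz := fun X a v => by ext <;> simp [D.leibniz, D'.leibniz]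

variable (A V V') in
/-- The endomorphisms of `V`, as endomorphisms of `V × V'` vanishing on `V'`. -/
def endInl : Module.End A V →ₗ[A] Module.End A (V × V') where
  toFun φ := LinearMap.inl A V V' ∘ₗ φ ∘ₗ LinearMap.fst A V V'
  map_add' φ ψ := by ext <;> simp
  map_smul' a φ := by ext <;> simp

variable (A V V') in
/-- The endomorphisms of `V'`, as endomorphisms of `V × V'` vanishing on `V`. -/
def endInr : Module.End A V' →ₗ[A] Module.End A (V × V') where
  toFun φ := LinearMap.inr A V V' ∘ₗ φ ∘ₗ LinearMap.snd A V V'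
  map_add' φ ψ := by ext <;> simp
  map_smul' a φ := by ext <;> simp

/-- The curvature of a direct sum is block diagonal. -/
lemma curvature_prod (D : Connection k A L V) (D' : Connection k A L V') :
    curvature (D.prod D') = (endInl A V V').compAlternatingMap (curvature D)
      + (endInr A V V').compAlternatingMap (curvature D') := by
  ext v <;> simp [curvature, curvatureEnd, Connection.prod, endInl, endInr]

lemma curvatureForm_prod_pow [Algebra ℚ A] (D : Connection k A L V) (D' : Connection k A L V')
    (m : ℕ) : curvatureForm k (D.prod D') ^ m = mapForms k (endInl A V V') (curvatureForm k D ^ m)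
      + mapForms k (endInr A V V') (curvatureForm k D' ^ m) := by
  induction m with
  | zero =>
    rw [pow_zero, pow_zero, pow_zero, one_eq_formOf (k := k), one_eq_formOf (k := k),
      one_eq_formOf (k := k), mapForms_formOf, mapForms_formOf, ← map_add]
    congr 1
    ext v <;> simp [endInl, endInr]
  | succ m ih =>
    have h : curvatureForm k (D.prod D') = mapForms k (endInl A V V') (curvatureForm k D)
      + mapForms k (endInr A V V') (curvatureForm k D') := by
      rw [curvatureForm, curvature_prod, map_add, curvatureForm, curvatureForm, mapForms_formOf,
        mapForms_formOf]
    have h1 := mapForms_mul_mapForms_eq_zero (k := k) (endInl A V V') (endInr A V V')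
      (fun φ ψ => by ext <;> simp [endInl, endInr]) (curvatureForm k D ^ m) (curvatureForm k D')
    have h2 := mapForms_mul_mapForms_eq_zero (k := k) (endInr A V V') (endInl A V V')
      (fun φ ψ => by ext <;> simp [endInl, endInr]) (curvatureForm k D' ^ m) (curvatureForm k D)
    rw [pow_succ, ih, h, pow_succ, pow_succ,
      mapForms_mul (endInl A V V') (fun φ ψ => by ext <;> simp [endInl]),
      mapForms_mul (endInr A V V') (fun φ ψ => by ext <;> simp [endInr])]
    have key : ∀ {Ω : Type _} [Ring Ω] {x x' y y' : Ω}, x * y' = 0 → x' * y = 0 →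
        (x + x') * (y + y') = x * y + x' * y' := fun hx hx' => by
      rw [mul_add, add_mul, add_mul, hx, hx', zero_add, add_zero]
    exact key h1 h2

variable [Module.Finite A V] [Module.Projective A V] [Module.Finite A V'] [Module.Projective A V']

/-- Extension by zero does not change the trace. -/
lemma projTrace_endInl : projTrace A (V × V') ∘ₗ endInl A V V' = projTrace A V := by
  refine LinearMap.ext fun φ => ?_
  obtain ⟨t, rfl⟩ := (dualTensorHomEquiv A V V).surjective φ
  induction t using TensorProduct.induction_on with
  | zero => simp
  | add x y hx hy => simp only [map_add, hx, hy]
  | tmul f v =>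
    have e : dualTensorHomEquiv A V V (f ⊗ₜ v) = dualTensorHom A V V (f ⊗ₜ v) := rfl
    have h : endInl A V V' (dualTensorHom A V V (f ⊗ₜ v)) = dualTensorHom A (V × V') (V × V')
        ((f ∘ₗ LinearMap.fst A V V') ⊗ₜ LinearMap.inl A V V' v) := by
      ext <;> simp [endInl]
    rw [LinearMap.comp_apply, e, h, projTrace_dualTensorHom, projTrace_dualTensorHom]
    simp

/-- Extension by zero does not change the trace. -/
lemma projTrace_endInr : projTrace A (V × V') ∘ₗ endInr A V V' = projTrace A V' := by
  refine LinearMap.ext fun φ => ?_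
  obtain ⟨t, rfl⟩ := (dualTensorHomEquiv A V' V').surjective φ
  induction t using TensorProduct.induction_on with
  | zero => simp
  | add x y hx hy => simp only [map_add, hx, hy]
  | tmul f v =>
    have e : dualTensorHomEquiv A V' V' (f ⊗ₜ v) = dualTensorHom A V' V' (f ⊗ₜ v) := rfl
    have h : endInr A V V' (dualTensorHom A V' V' (f ⊗ₜ v)) = dualTensorHom A (V × V') (V × V')
        ((f ∘ₗ LinearMap.snd A V V') ⊗ₜ LinearMap.inr A V V' v) := by
      ext <;> simp [endInr]
    rw [LinearMap.comp_apply, e, h, projTrace_dualTensorHom, projTrace_dualTensorHom]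
    simp

/-- The Chern form of a direct sum of connections is the sum of the Chern forms. -/
theorem chernForm_prod [Algebra ℚ A] [Module.Finite A L] (κ : k) (D : Connection k A L V)
    (D' : Connection k A L V') :
    chernForm κ (D.prod D') = chernForm κ D + chernForm κ D' := by
  obtain ⟨N, hN⟩ := exists_curvatureForm_pow_eq_zero (k := k) (A := A) (L := L) (V := V)
  obtain ⟨N', hN'⟩ := exists_curvatureForm_pow_eq_zero (k := k) (A := A) (L := L) (V := V')
  have h : ∀ m, max N N' ≤ m → curvatureForm k D ^ m = 0 := fun m hm =>
    hN D m (le_trans (le_max_left _ _) hm)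
  have h' : ∀ m, max N N' ≤ m → curvatureForm k D' ^ m = 0 := fun m hm =>
    hN' D' m (le_trans (le_max_right _ _) hm)
  rw [chernForm, chernForm, chernForm, expCurvature_eq_sum κ D h, expCurvature_eq_sum κ D' h',
    expCurvature_eq_sum κ (D.prod D') (n := max N N') (fun m hm => by
      rw [curvatureForm_prod_pow, h m hm, h' m hm, map_zero, map_zero, add_zero]),
    map_sum, map_sum, map_sum, ← Finset.sum_add_distrib]
  refine Finset.sum_congr rfl fun m _ => ?_
  rw [map_smul, map_smul, map_smul, ← smul_add, curvatureForm_prod_pow, map_add, mapForms_comp,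
    mapForms_comp, projTrace_endInl, projTrace_endInr]

end DirectSum

/-! ### The tensor product of two connections -/

section Tensor

variable {k A L V V' : Type*} [Field k] [CharZero k] [CommRing A] [Algebra k A]
  [LieRing L] [LieAlgebra k L] [Module A L] [LieRingModule L A] [LieRinehartRing A L]
  [LieRinehartAlgebra k A L]
  [AddCommGroup V] [Module k V] [Module A V] [IsScalarTower k A V]
  [AddCommGroup V'] [Module k V'] [Module A V'] [IsScalarTower k A V']

/-- `v ⊗ v' ↦ ∇_X v ⊗ v' + v ⊗ ∇'_X v'`. Neither summand is well defined on `V ⊗[A] V'`. -/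
noncomputable def tensorConnectionHom (D : Connection k A L V) (D' : Connection k A L V') (X : L) :
    V ⊗[A] V' →+ V ⊗[A] V' :=
  TensorProduct.liftAddHom
    (AddMonoidHom.mk' (fun v => AddMonoidHom.mk'
        (fun v' => D.toLin X v ⊗ₜ[A] v' + v ⊗ₜ[A] D'.toLin X v')
        (fun v' w' => by simp only [map_add, TensorProduct.tmul_add]; abel))
      (fun v w => by
        ext v'
        simp only [map_add, TensorProduct.add_tmul, AddMonoidHom.mk'_apply, AddMonoidHom.add_apply]
        abel))
    (fun a v v' => by
      simp only [AddMonoidHom.mk'_apply, D.leibniz, D'.leibniz, TensorProduct.add_tmul,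
        TensorProduct.tmul_add, TensorProduct.smul_tmul, TensorProduct.tmul_smul]
      abel)

lemma tensorConnectionHom_tmul (D : Connection k A L V) (D' : Connection k A L V') (X : L)
    (v : V) (v' : V') : tensorConnectionHom D D' X (v ⊗ₜ v')
      = D.toLin X v ⊗ₜ[A] v' + v ⊗ₜ[A] D'.toLin X v' := rfl

lemma tensorConnectionHom_leibniz (D : Connection k A L V) (D' : Connection k A L V') (X : L)
    (a : A) (t : V ⊗[A] V') : tensorConnectionHom D D' X (a • t)
      = ⁅X, a⁆ • t + a • tensorConnectionHom D D' X t := by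
  induction t using TensorProduct.induction_on with
  | zero => simp
  | add x y hx hy => simp only [smul_add, map_add, hx, hy]; abel
  | tmul v v' =>
    rw [TensorProduct.smul_tmul', tensorConnectionHom_tmul, tensorConnectionHom_tmul, D.leibniz]
    simp only [TensorProduct.add_tmul, TensorProduct.smul_tmul', smul_add]
    abel

/-- The tensor product of two connections. -/
noncomputable def Connection.tensor (D : Connection k A L V) (D' : Connection k A L V') :
    Connection k A L (V ⊗[A] V') where
  toLin :=
    { toFun := fun X =>
        { toFun := tensorConnectionHom D D' X
          map_add' := map_add _
          map_smul' := fun c t => by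
            -- `k`-linearity follows from the Leibniz rule, as `X` kills constants.
            have hc : ⁅X, algebraMap k A c⁆ = 0 := by
              have h1 : ⁅X, (1 : A)⁆ = 0 := by
                simpa using LieRinehartRing.leibniz_mul_right X (1 : A) 1
              rw [Algebra.algebraMap_eq_smul_one]
              exact (lie_smul c X (1 : A)).trans (by rw [h1, smul_zero])
            rw [← algebraMap_smul A c t, tensorConnectionHom_leibniz, hc, zero_smul, zero_add,
              algebraMap_smul]
            rfl }
      map_add' := fun X Y => by
        ext t
        change tensorConnectionHom D D' (X + Y) t
          = tensorConnectionHom D D' X t + tensorConnectionHom D D' Y t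
        induction t using TensorProduct.induction_on with
        | zero => simp
        | add x y hx hy => simp only [map_add, hx, hy]; abel
        | tmul v v' =>
          simp only [tensorConnectionHom_tmul, map_add, LinearMap.add_apply,
            TensorProduct.add_tmul, TensorProduct.tmul_add]
          abel
      map_smul' := fun a X => by
        ext t
        change tensorConnectionHom D D' (a • X) t = a • tensorConnectionHom D D' X t
        induction t using TensorProduct.induction_on with
        | zero => simp
        | add x y hx hy => simp only [map_add, hx, hy, smul_add]
        | tmul v v' =>
          simp only [tensorConnectionHom_tmul, map_smul, LinearMap.smul_apply, smul_add,
            TensorProduct.smul_tmul', TensorProduct.tmul_smul] }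
  leibniz := tensorConnectionHom_leibniz D D'

lemma tensor_toLin_tmul (D : Connection k A L V) (D' : Connection k A L V') (X : L)
    (v : V) (v' : V') : (D.tensor D').toLin X (v ⊗ₜ v')
      = D.toLin X v ⊗ₜ[A] v' + v ⊗ₜ[A] D'.toLin X v' := rfl

lemma curvature_apply (D : Connection k A L V) (x : Fin 2 → L) (v : V) :
    curvature D x v = D.toLin (x 0) (D.toLin (x 1) v) - D.toLin (x 1) (D.toLin (x 0) v)
      - D.toLin ⁅x 0, x 1⁆ v := rfl

/-- The curvature of a tensor product is `R ⊗ 1 + 1 ⊗ R'`. -/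
lemma curvature_tensor (D : Connection k A L V) (D' : Connection k A L V') :
    curvature (D.tensor D')
      = (Module.End.rTensorAlgHom A V V').toLinearMap.compAlternatingMap (curvature D)
        + (Module.End.lTensorAlgHom A V' V).toLinearMap.compAlternatingMap (curvature D') := by
  refine AlternatingMap.ext fun x => TensorProduct.ext' fun v v' => ?_
  change _ = curvature D x v ⊗ₜ[A] v' + v ⊗ₜ[A] curvature D' x v'
  simp only [curvature_apply, tensor_toLin_tmul, map_add, TensorProduct.sub_tmul,
    TensorProduct.tmul_sub]
  abel

variable [Module.Finite A V] [Module.Projective A V] [Module.Finite A V'] [Module.Projective A V']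

/-- The trace is multiplicative for tensor products. -/
lemma projTrace_rTensor_mul_lTensor (φ : Module.End A V) (ψ : Module.End A V') :
    projTrace A (V ⊗[A] V') (φ.rTensor V' * ψ.lTensor V)
      = projTrace A V φ * projTrace A V' ψ := by
  obtain ⟨s, rfl⟩ := (dualTensorHomEquiv A V V).surjective φ
  obtain ⟨t, rfl⟩ := (dualTensorHomEquiv A V' V').surjective ψ
  induction s using TensorProduct.induction_on with
  | zero => simp
  | add x y hx hy => simp only [map_add, LinearMap.rTensor_add, add_mul, hx, hy]
  | tmul f v =>
    induction t using TensorProduct.induction_on with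
    | zero => simp
    | add x y hx hy => simp only [map_add, LinearMap.lTensor_add, mul_add, hx, hy]
    | tmul g v' =>
      have e : dualTensorHomEquiv A V V (f ⊗ₜ v) = dualTensorHom A V V (f ⊗ₜ v) := rfl
      have e' : dualTensorHomEquiv A V' V' (g ⊗ₜ v') = dualTensorHom A V' V' (g ⊗ₜ v') := rfl
      have h : (dualTensorHom A V V (f ⊗ₜ v)).rTensor V'
          * (dualTensorHom A V' V' (g ⊗ₜ v')).lTensor V = dualTensorHom A (V ⊗[A] V') (V ⊗[A] V')
            ((LinearMap.mul' A A ∘ₗ TensorProduct.map f g) ⊗ₜ (v ⊗ₜ v')) := by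
        ext w w'
        simp [TensorProduct.smul_tmul', TensorProduct.tmul_smul, smul_smul, mul_comm]
      rw [e, e', h, projTrace_dualTensorHom, projTrace_dualTensorHom, projTrace_dualTensorHom]
      simp

/-- The Chern form of a tensor product of connections is the product of the Chern forms. -/
theorem chernForm_tensor [Algebra ℚ A] [Module.Finite A L] (κ : k) (D : Connection k A L V)
    (D' : Connection k A L V') :
    chernForm κ (D.tensor D') = cupForms k A L (chernForm κ D) (chernForm κ D') := by
  obtain ⟨N₁, h₁⟩ := exists_curvatureForm_pow_eq_zero (k := k) (A := A) (L := L) (V := V)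
  obtain ⟨N₂, h₂⟩ := exists_curvatureForm_pow_eq_zero (k := k) (A := A) (L := L) (V := V')
  obtain ⟨N₃, h₃⟩ := exists_curvatureForm_pow_eq_zero (k := k) (A := A) (L := L) (V := V ⊗[A] V')
  -- All three exponentials are truncated at the same degree.
  let n := max N₁ (max N₂ N₃)
  have hn₁ : ∀ m, n ≤ m → curvatureForm k D ^ m = 0 := fun m hm => h₁ D m (by omega)
  have hn₂ : ∀ m, n ≤ m → curvatureForm k D' ^ m = 0 := fun m hm => h₂ D' m (by omega)
  have hn₃ : ∀ m, n ≤ m → curvatureForm k (D.tensor D') ^ m = 0 := fun m hm => h₃ _ m (by omega)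
  let a : Module.End A V →ₐ[A] Module.End A (V ⊗[A] V') := Module.End.rTensorAlgHom A V V'
  let b : Module.End A V' →ₐ[A] Module.End A (V ⊗[A] V') := Module.End.lTensorAlgHom A V' V
  have hR : curvatureForm k (D.tensor D') = mapFormsAlgHom (k := k) a (curvatureForm k D)
      + mapFormsAlgHom (k := k) b (curvatureForm k D') := by
    rw [curvatureForm, curvature_tensor, map_add, ← mapForms_formOf, ← mapForms_formOf]
    rfl
  have hc : Commute (mapFormsAlgHom (k := k) a (curvatureForm k D))
      (mapFormsAlgHom (k := k) b (curvatureForm k D')) :=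
    commute_mapForms_of_commute a.toLinearMap b.toLinearMap
      (fun φ ψ => TensorProduct.ext' fun v v' => rfl) _ _
  rw [chernForm, chernForm, chernForm,
    ← mapForms_mapForms_mul_mapForms a.toLinearMap b.toLinearMap (projTrace A (V ⊗[A] V')) _ _
      projTrace_rTensor_mul_lTensor,
    expCurvature_eq_sum κ D hn₁, expCurvature_eq_sum κ D' hn₂, expCurvature_eq_sum κ _ hn₃, hR,
    sum_pow_smul_add_of_commute κ hc (by rw [← map_pow, hn₁ n le_rfl, map_zero])
      (by rw [← map_pow, hn₂ n le_rfl, map_zero]) (by rw [← hR, hn₃ n le_rfl])]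
  simp only [← map_pow, ← map_smul, ← map_sum]
  rfl

end Tensor

end LieRinehart

theorem mainTheorem2 {k A L V V' : Type*} [Field k] [CharZero k] [CommRing A] [Algebra k A]
    [LieRing L] [LieAlgebra k L] [Module A L] [LieRingModule L A] [LieRinehartRing A L]
    [LieRinehartAlgebra k A L] [Module.Finite A L]
    [AddCommGroup V] [Module k V] [Module A V] [IsScalarTower k A V]
    [Module.Finite A V] [Module.Projective A V]
    [AddCommGroup V'] [Module k V'] [Module A V'] [IsScalarTower k A V']
    [Module.Finite A V'] [Module.Projective A V']
    (κ : k) (hκ : κ ≠ 0) :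
    (∀ D : LieRinehart.Connection k A L V,
      LieRinehart.chernClass κ D = LieRinehart.chernCharacter k A L V κ) ∧
    (∀ D' : LieRinehart.Connection k A L V',
      LieRinehart.chernClass κ D' = LieRinehart.chernCharacter k A L V' κ) ∧
    LieRinehart.chernCharacter k A L (V × V') κ
      = LieRinehart.chernCharacter k A L V κ + LieRinehart.chernCharacter k A L V' κ ∧
    LieRinehart.chernCharacter k A L (V ⊗[A] V') κ
      = LieRinehart.HdR.cup k A L (LieRinehart.chernCharacter k A L V κ)
          (LieRinehart.chernCharacter k A L V' κ) := by
  let _ : Algebra ℚ A := ((algebraMap k A).comp (algebraMap ℚ k)).toAlgebra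
  have hV := LieRinehart.Connection.nonempty_of_projective (k := k) (A := A) (L := L) (V := V)
  have hV' := LieRinehart.Connection.nonempty_of_projective (k := k) (A := A) (L := L) (V := V')
  -- Independence of the connection gives the first two claims, and allows to compute with the
  -- direct sum and the tensor product of two connections in the others.
  refine ⟨fun D => LieRinehart.chernClass_eq κ _ _, fun D' => LieRinehart.chernClass_eq κ _ _,
    ?_, ?_⟩
  · refine (LieRinehart.chernClass_eq κ _ (hV.some.prod hV'.some)).trans ?_
    exact congrArg Submodule.Quotient.mk (Subtype.ext (LieRinehart.chernForm_prod κ _ _))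
  · refine (LieRinehart.chernClass_eq κ _ (hV.some.tensor hV'.some)).trans ?_
    refine Eq.trans ?_ (LieRinehart.HdR.cup_mk k A L _ _).symm
    exact congrArg Submodule.Quotient.mk (Subtype.ext (LieRinehart.chernForm_tensor κ _ _))
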